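/- **Scheme.** Let $S\ge 2$ divide $d\ge 1$, $\alpha=1/S$, $\ell=d-d/S$, $\mathcal S=\{0,\dots,S-1\}$, and $\mathcal I(s)=\{s(d-\ell),\dots,(s+1)(d-\ell)-1\}$ for $s\in\mathcal S$. For $x\in\{0,1\}^d$ let $|\mu(x)\rangle=d^{-1/2}\sum_{j}(-1)^{x_j}|j\rangle\in\mathbb C^d$. Messages $x\in\mathcal S^K$ are encoded to codewords $c\in\mathcal S^N$; codewords of distinct messages have Hamming distance at least $2\theta N$ (the code corrects symbol error rate $\theta$). The private key is $k=(k^1,\dots,k^N)$ with $k^i\in\{0,1\}^d$; each copy of the public key is $|P_k\rangle=\bigotimes_i|\mu(k^i)\rangle$. The signature of $x$ consists of the substrings $\kappa_i$ of $k^i$ at the positions outside $\mathcal I(c_i)$. To verify $(x',(\kappa'_i)_i)$, with $c'$ the codeword of $x'$, the verifier measures, for each $i$, the projection of the $i$-th qudit onto the normalized vector $\psi_i\propto\sum_{k:\,k_{[d]\setminus\mathcal I(c'_i)}=\kappa'_i}|\mu(k)\rangle$, and counts the number $z$ of failed projections. The result is 1-ACC if $z\le z_{\rm acc}$, REJ if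 $z\ge z_{\rm rej}$, and 0-ACC in between. **Definitions.** The scheme is *correct with error $\varepsilon$* if for every key and message the verification of the honest signature on $|P_k\rangle$ gives 1-ACC with probability at least $1-\varepsilon$. It is *$\varepsilon$-secure against forgery* if, for uniformly random $k$, every computationally unbounded quantum adversary that holds $|P_k\rangle^{\otimes T}$, chooses (after any measurement) a message $m$, receives its signature, and outputs $(m',r')$ after a further measurement, satisfies $\Pr[m'\ne m\wedge{\sf Verif}(|P_k\rangle,m',r')\ne{\rm REJ}]\le\varepsilon$. **Proposition.** Let $\varphi=T\log_2 d/d\le\alpha$, let $h^{\rm inv}:[0,1]\to[0,\frac12]$ be the inverse of the binary entropy function (in bits), and let $$p_1=(1-\alpha)\Big[\Big(1-\tfrac{\alpha}{1-\alpha}\,2h^{\rm inv}\big(1-\tfrac{\varphi}{\alpha}\big)\Big)^2+\sqrt{\tfrac83}\,\frac{\sqrt{d-\ell}}{\ell}\Big].$$ Assume $1-p_1-\alpha>0$. Let $\varepsilon_{\rm c},\varepsilon_{\rm f}\in(0,1)$, let $\nu>\alpha$ be a constant, and set $$\theta=\tfrac\alpha2(1+\nu),\qquad N\ \ge\ \frac1{\alpha^3}\left(\frac{\sqrt{3\ln\varepsilon_{\rm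 c}^{-1}}+\sqrt{1+4\theta}\sqrt{2\ln\varepsilon_{\rm f}^{-1}}}{(1-p_1-\alpha)/\alpha}\right)^2\quad(N\in\mathbb N),$$ $$z_{\rm acc}=N\alpha+\sqrt{N\alpha}\sqrt{3\ln\varepsilon_{\rm c}^{-1}},\qquad z_{\rm rej}=E-\sqrt{E}\sqrt{2\ln\varepsilon_{\rm f}^{-1}},\quad E=(1-2\theta)N\alpha+2\theta N(1-p_1).$$ Then $\alpha N\le z_{\rm acc}<z_{\rm rej}$, the scheme is correct with error $\varepsilon_{\rm c}$, and it is $\varepsilon_{\rm f}$-secure against forgery. -/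

import Mathlib

noncomputable section

open scoped BigOperators

/-! ## Quantum-public-key signature schemes: general notions -/

/-- The three possible results of a verification: `acc1` is 1-ACC, `acc0` is 0-ACC. -/
inductive Verdict where
  | rej
  | acc0
  | acc1
  deriving DecidableEq

/-- A signature scheme with classical private keys and quantum public keys.  The public-key Hilbert
space has orthonormal basis `ι`.  `verif P m r v` is the probability that the verification of the
state `P`, the message `m` and the alleged signature `r` has the result `v`. -/
structure SignatureScheme (ι Key Msg Sig : Type) where
  pub : Key → EuclideanSpace ℂ ι
  sign : Key → Msg → Sig
  verif : EuclideanSpace ℂ ι → Msg → Sig → Verdict → ℝ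

/-- Correctness with error `ε`: for every private key and every message, an honest signature gets
the result 1-ACC with probability at least `1 - ε`. -/
def SignatureScheme.IsCorrect {ι Key Msg Sig : Type} (Q : SignatureScheme ι Key Msg Sig)
    (ε : ℝ) : Prop :=
  ∀ (k : Key) (m : Msg), 1 - ε ≤ Q.verif (Q.pub k) m (Q.sign k m) Verdict.acc1

/-- The state `ψ ⊗ ⋯ ⊗ ψ` (`T` factors), in the product basis. -/
def tensorCopies {ι : Type} (T : ℕ) (ψ : EuclideanSpace ℂ ι) : EuclideanSpace ℂ (Fin T → ι) :=
  WithLp.toLp 2 fun a => ∏ t, ψ (a t)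

/-- A computationally unbounded quantum forger that is given `T` copies of the public key.
It first performs a general measurement on the copies, whose outcome is the message `m` it wants to
see signed; `meas m` is the measurement operator, and it maps the initial state to the
(unnormalized) state that the forger keeps, in an arbitrary Hilbert space `V` (which can hold
ancillas, private randomness and the environment).  Given the signature `r` of `m`, the forger
measures its state with the POVM `povm m r`, whose outcome is the forgery `(m', r')`. -/
structure ForgeryAdversary (ι Msg Sig : Type) [Fintype ι] [Fintype Msg] [Fintype Sig] (T : ℕ)
    (V : Type) [NormedAddCommGroup V] [InnerProductSpace ℂ V] [CompleteSpace V] where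
  meas : Msg → EuclideanSpace ℂ (Fin T → ι) →L[ℂ] V
  meas_complete : ∀ φ, ∑ m, ‖meas m φ‖ ^ 2 = ‖φ‖ ^ 2
  povm : Msg → Sig → Msg × Sig → V →L[ℂ] V
  povm_pos : ∀ m r o, (povm m r o).IsPositive
  povm_sum : ∀ m r, ∑ o, povm m r o = 1

/-- Probability that the forger, for the private key `k`, asks for the signature of `m` and then
outputs the pair `o = (m', r')`. -/
def ForgeryAdversary.outputProb {ι Key Msg Sig : Type} [Fintype ι] [Fintype Msg] [Fintype Sig]
    {T : ℕ} {V : Type} [NormedAddCommGroup V] [InnerProductSpace ℂ V] [CompleteSpace V]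
    (A : ForgeryAdversary ι Msg Sig T V) (Q : SignatureScheme ι Key Msg Sig)
    (k : Key) (m : Msg) (o : Msg × Sig) : ℝ :=
  (inner ℂ (A.meas m (tensorCopies T (Q.pub k)))
    (A.povm m (Q.sign k m) o (A.meas m (tensorCopies T (Q.pub k))))).re

open Classical in
/-- Probability that `m' ≠ m` and the verification of `(m', r')` does not give REJ, for a uniformly
random private key. -/
def ForgeryAdversary.forgeryProb {ι Key Msg Sig : Type} [Fintype ι] [Fintype Key] [Fintype Msg]
    [Fintype Sig] {T : ℕ} {V : Type} [NormedAddCommGroup V] [InnerProductSpace ℂ V]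
    [CompleteSpace V] (A : ForgeryAdversary ι Msg Sig T V)
    (Q : SignatureScheme ι Key Msg Sig) : ℝ :=
  (Fintype.card Key : ℝ)⁻¹ * ∑ k : Key, ∑ m : Msg, ∑ o : Msg × Sig,
    if o.1 ≠ m then
      A.outputProb Q k m o *
        (Q.verif (Q.pub k) o.1 o.2 Verdict.acc0 + Q.verif (Q.pub k) o.1 o.2 Verdict.acc1)
    else 0

/-- `ε`-security against forgery, against forgers that hold `T` copies of the public key. -/
def SignatureScheme.IsForgerySecure {ι Key Msg Sig : Type} [Fintype ι] [Fintype Key] [Fintype Msg]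
    [Fintype Sig] (Q : SignatureScheme ι Key Msg Sig) (T : ℕ) (ε : ℝ) : Prop :=
  ∀ (V : Type) [NormedAddCommGroup V] [InnerProductSpace ℂ V] [CompleteSpace V]
    (A : ForgeryAdversary ι Msg Sig T V), A.forgeryProb Q ≤ ε

/-! ## The fingerprinting scheme for nonbinary symbols -/

/-- The fingerprinting state `d^{-1/2} ∑ⱼ (-1)^{xⱼ} |j⟩`. -/
def fingerprint {d : ℕ} (x : Fin d → Bool) : EuclideanSpace ℂ (Fin d) :=
  WithLp.toLp 2 fun j => (((Real.sqrt d)⁻¹ : ℝ) : ℂ) * (if x j then -1 else 1)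

/-- The set `I(s) = {s(d-ℓ), …, (s+1)(d-ℓ)-1}` of positions that are not revealed when the symbol
`s` is signed, where `d - ℓ = d/S`. -/
def hiddenSet (d S : ℕ) (s : Fin S) : Finset (Fin d) :=
  Finset.univ.filter fun j => (s : ℕ) * (d / S) ≤ (j : ℕ) ∧ (j : ℕ) < ((s : ℕ) + 1) * (d / S)

/-- The `j`-th element, in increasing order, of the complement of `I(s)`; here `ℓ = d - d/S`. -/
def revealedPos (d S : ℕ) (s : Fin S) (j : Fin (d - d / S)) : Fin d :=
  if (j : ℕ) < (s : ℕ) * (d / S) then ⟨j, j.isLt.trans_le (Nat.sub_le _ _)⟩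
  else ⟨(j : ℕ) + d / S, Nat.add_lt_of_lt_sub j.isLt⟩

theorem revealedPos_val (d S : ℕ) (s : Fin S) (j : Fin (d - d / S)) :
    (revealedPos d S s j : ℕ)
      = if (j : ℕ) < (s : ℕ) * (d / S) then (j : ℕ) else (j : ℕ) + d / S := by
  unfold revealedPos
  split_ifs <;> rfl

theorem revealedPos_strictMono (d S : ℕ) (s : Fin S) : StrictMono (revealedPos d S s) := by
  intro i j hij
  have hij' : (i : ℕ) < (j : ℕ) := hij
  have hij2 : (i : ℕ) < (j : ℕ) + d / S := hij'.trans_le (Nat.le_add_right _ _)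
  rw [Fin.lt_def, revealedPos_val, revealedPos_val]
  split_ifs <;> omega

theorem range_revealedPos (d S : ℕ) (s : Fin S) :
    Set.range (revealedPos d S s) = {j | j ∉ hiddenSet d S s} := by
  have hmul : ((s : ℕ) + 1) * (d / S) = (s : ℕ) * (d / S) + d / S := by ring
  have hle : (s : ℕ) * (d / S) + d / S ≤ d := by
    rw [← hmul]
    exact (Nat.mul_le_mul_right _ s.isLt).trans (Nat.mul_div_le d S)
  ext p
  have hp := p.isLt
  simp only [Set.mem_range, Set.mem_ofPred_eq, hiddenSet, Finset.mem_filter, Finset.mem_univ,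
    true_and, hmul, Fin.ext_iff, revealedPos_val]
  constructor
  · rintro ⟨j, hj⟩
    split_ifs at hj <;> omega
  · intro h
    by_cases hlt : (p : ℕ) < (s : ℕ) * (d / S)
    · have h0 : (p : ℕ) < d - d / S := by
        generalize d / S = n at *
        omega
      exact ⟨⟨p, h0⟩, if_pos hlt⟩
    · have h0 : (p : ℕ) - d / S < d - d / S ∧ ¬ ((p : ℕ) - d / S < (s : ℕ) * (d / S)) ∧
          (p : ℕ) - d / S + d / S = p := by
        generalize d / S = n at *
        generalize (s : ℕ) * n = q at *
        omega
      exact ⟨⟨(p : ℕ) - d / S, h0.1⟩, (if_neg h0.2.1).trans h0.2.2⟩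

/-- The revealed substring of `k` when the symbol `s` is signed. -/
def revealedSubstring {d S : ℕ} (k : Fin d → Bool) (s : Fin S) : Fin (d - d / S) → Bool :=
  fun j => k (revealedPos d S s j)

/-- The normalized vector `ψ` proportional to the sum of all fingerprinting states that are
consistent with the revealed substring `κ` for the symbol `s`. -/
def testVector {d S : ℕ} (s : Fin S) (κ : Fin (d - d / S) → Bool) : EuclideanSpace ℂ (Fin d) :=
  let v : EuclideanSpace ℂ (Fin d) :=
    ∑ k ∈ Finset.univ.filter (fun k : Fin d → Bool => revealedSubstring k s = κ), fingerprint k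
  (((‖v‖)⁻¹ : ℝ) : ℂ) • v

/-- The projector `|ψ⟩⟨ψ|` (outcome '1'), as a matrix. -/
def testProjector {d S : ℕ} (s : Fin S) (κ : Fin (d - d / S) → Bool) :
    Matrix (Fin d) (Fin d) ℂ :=
  Matrix.of fun a a' => testVector s κ a * star (testVector s κ a')

/-- The joint projector on the `N` qudits for the outcome pattern `b`, where `b i = true` means
that the `i`-th qudit gives the outcome '0' (an error). -/
def patternProjector {d S N : ℕ} (c : Fin N → Fin S) (κ : Fin N → Fin (d - d / S) → Bool)
    (b : Fin N → Bool) : Matrix (Fin N → Fin d) (Fin N → Fin d) ℂ :=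
  Matrix.of fun a a' => ∏ i,
    (if b i then 1 - testProjector (c i) (κ i) else testProjector (c i) (κ i)) (a i) (a' i)

/-- Born probability of the outcome pattern `b` on the `N`-qudit state `P`. -/
def patternProb {d S N : ℕ} (c : Fin N → Fin S) (κ : Fin N → Fin (d - d / S) → Bool)
    (P : EuclideanSpace ℂ (Fin N → Fin d)) (b : Fin N → Bool) : ℝ :=
  (∑ a, ∑ a', star (P a) * patternProjector c κ b a a' * P a').re

/-- The verification result for an error tally `z`. -/
def verdictOf (zacc zrej : ℝ) (z : ℕ) : Verdict :=
  if (z : ℝ) ≤ zacc then Verdict.acc1 else if zrej ≤ (z : ℝ) then Verdict.rej else Verdict.acc0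

/-- The signature scheme: messages in `S^K`, encoded by `enc` to codewords in `S^N`; private key
`(kⁱ)` with `kⁱ ∈ {0,1}^d`; public key `|μ(k¹)⟩ ⊗ ⋯ ⊗ |μ(k^N)⟩`; thresholds `zacc`, `zrej`. -/
def fingerprintScheme {K N : ℕ} (d S : ℕ) (enc : (Fin K → Fin S) → (Fin N → Fin S))
    (zacc zrej : ℝ) :
    SignatureScheme (Fin N → Fin d) (Fin N → Fin d → Bool) (Fin K → Fin S)
      (Fin N → Fin (d - d / S) → Bool) where
  pub k := WithLp.toLp 2 fun a => ∏ i, fingerprint (k i) (a i)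
  sign k x := fun i => revealedSubstring (k i) (enc x i)
  verif P x r v := ∑ b ∈ Finset.univ.filter (fun b : Fin N → Bool =>
      verdictOf zacc zrej (Finset.univ.filter (fun i => b i = true)).card = v),
    patternProb (enc x) r P b

/-! ## The parameter settings -/

/-- Binary entropy, in bits. -/
def binEntropyBits (p : ℝ) : ℝ := Real.binEntropy p / Real.log 2

/-- Inverse of the binary entropy function on `[0, 1/2]`. -/
def binEntropyInv (y : ℝ) : ℝ := sInf {p : ℝ | 0 ≤ p ∧ p ≤ 1 / 2 ∧ y ≤ binEntropyBits p}

/-- `φ = T log₂ d / d`. -/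
def phiParam (d T : ℕ) : ℝ := T * Real.logb 2 d / d

/-- The bound `p₁`; here `ℓ = (1-α)d` and `d - ℓ = αd`. -/
def p1Param (α : ℝ) (d T : ℕ) : ℝ :=
  (1 - α) * ((1 - α / (1 - α) * (2 * binEntropyInv (1 - phiParam d T / α))) ^ 2
    + Real.sqrt (8 / 3) * (Real.sqrt (α * d) / ((1 - α) * d)))

/-- The code error rate `θ`. -/
def thetaParam (α ν : ℝ) : ℝ := α / 2 * (1 + ν)

/-- The value prescribed for the codeword length `N`. -/
def lengthParam (α ν : ℝ) (d T : ℕ) (εc εf : ℝ) : ℝ :=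
  1 / α ^ 3 * ((Real.sqrt (3 * Real.log εc⁻¹)
      + Real.sqrt (1 + 4 * thetaParam α ν) * Real.sqrt (2 * Real.log εf⁻¹))
    / ((1 - p1Param α d T - α) / α)) ^ 2

/-- The acceptance threshold. -/
def zAccParam (α : ℝ) (N : ℕ) (εc : ℝ) : ℝ :=
  N * α + Real.sqrt (N * α) * Real.sqrt (3 * Real.log εc⁻¹)

/-- The rejection threshold. -/
def zRejParam (α ν : ℝ) (d T N : ℕ) (εf : ℝ) : ℝ :=
  (1 - 2 * thetaParam α ν) * N * α + 2 * thetaParam α ν * N * (1 - p1Param α d T)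
    - Real.sqrt ((1 - 2 * thetaParam α ν) * N * α + 2 * thetaParam α ν * N * (1 - p1Param α d T))
      * Real.sqrt (2 * Real.log εf⁻¹)

end

/-! Let `n = d / S`. Fix a transcript (requested message and forgery), all other key strings and the
revealed bits of one key string. The signature is then constant. A positive POVM element has the
form `B* B`, so the transcript has probability `‖g h‖ ^ 2`, where `g` is a linear image of `T`
copies of the public key. Each copy contributes at most one sign of the `n` hidden bits `h`, so `g`
is a polynomial of degree at most `T` in these signs.

Where the two codewords differ, the hidden blocks are disjoint. The pass probability is then `(R + ∑
τⱼ (-1)^{hⱼ}) ^ 2 / (d (d - n))` with `|R| ≤ d - 2n` and `|τⱼ| ≤ 1`. Induction on the number of bits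
shows that, under the density `‖g‖ ^ 2`, the linear form has second moment at most `(4T - 1) n` (at
most `n` if `T = 0`). Apart from a few small parameters, `4T - 1 ≤ T log₂ d`. With `y = φ / α`, the
root mean square of the statistic is then at most `d - 2n + n √y`. The bound `h(p) ≥ 4p(1-p)` gives
`hinv(1 - y) ≤ (1 - √y) / 2`, which turns this into the square in `p₁`. The additive term of `p₁`
covers `T = 0` and the small cases.

Where the codewords agree, no substring passes with probability above `1 - α`. These bounds hold
conditionally on all other key strings, so they multiply and control the exponential moment of the
error tally. Chernoff bounds then give both error probabilities, and the condition on `N` separates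
the thresholds. -/

/-! ### A quadratic lower bound for the binary entropy -/

theorem four_mul_log_two_mul_le_binEntropy {p : ℝ} (h0 : 0 ≤ p) (h1 : p ≤ 1) :
    4 * Real.log 2 * (p * (1 - p)) ≤ Real.binEntropy p := by
  set f : ℝ → ℝ := fun x => Real.binEntropy x - 4 * Real.log 2 * (x * (1 - x)) with hf
  have hlog : 0.6931471803 < Real.log 2 := Real.log_two_gt_d9
  have hcont : Continuous f := by
    have := Real.binEntropy_continuous
    fun_prop
  have hsymm : ∀ x, f (1 - x) = f x := by
    intro x
    simp only [hf, Real.binEntropy_one_sub]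
    ring
  have hhalf : f (1 / 2) = 0 := by
    have : Real.binEntropy (1 / 2) = Real.log 2 := by
      rw [one_div]; exact Real.binEntropy_two_inv
    simp only [hf, this]
    ring
  have hd1 : ∀ x : ℝ, 0 < x → x < 1 →
      HasDerivAt f (Real.log (1 - x) - Real.log x - 4 * Real.log 2 * (1 - 2 * x)) x := by
    intro x hx0 hx1
    have h := (Real.hasDerivAt_binEntropy hx0.ne' hx1.ne).sub
      (((hasDerivAt_id x).mul ((hasDerivAt_id x).const_sub 1)).const_mul (4 * Real.log 2))
    refine h.congr_deriv ?_
    simp only [id]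
    ring
  have hd2 : ∀ x : ℝ, 0 < x → x < 1 →
      HasDerivAt (fun x => Real.log (1 - x) - Real.log x - 4 * Real.log 2 * (1 - 2 * x))
        (8 * Real.log 2 - 1 / (x * (1 - x))) x := by
    intro x hx0 hx1
    have h := ((((hasDerivAt_id x).const_sub 1).log (by simp; linarith)).sub
      ((hasDerivAt_id x).log hx0.ne')).sub
      ((((hasDerivAt_id x).const_mul 2).const_sub 1).const_mul (4 * Real.log 2))
    have h' : (1 : ℝ) - x ≠ 0 := by linarith
    have h'' : x ≠ 0 := hx0.ne'
    refine h.congr_deriv ?_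
    simp only [id]
    field_simp
    ring
  -- `q` below is the smaller root of `x (1 - x) = 1 / (8 log 2)`, where the second derivative of
  -- `f` changes sign. The roots are real because `2 log 2 ≥ 1`.
  set D : ℝ := 1 - 1 / (2 * Real.log 2) with hD
  have hD0 : 0 ≤ D := by
    rw [hD, sub_nonneg, div_le_one (by linarith)]
    linarith
  have hlp : 0 < Real.log 2 := by linarith
  have hD1 : D < 1 := by
    rw [hD]
    have : 0 < 1 / (2 * Real.log 2) := by positivity
    linarith
  set q : ℝ := (1 - Real.sqrt D) / 2 with hq
  have hs1 : Real.sqrt D < 1 := by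
    rw [Real.sqrt_lt' one_pos]; simpa using hD1
  have hs0 : 0 ≤ Real.sqrt D := Real.sqrt_nonneg _
  have hss : Real.sqrt D ^ 2 = D := Real.sq_sqrt hD0
  have hqq : q * (1 - q) * (8 * Real.log 2) = 1 := by
    have : q * (1 - q) = (1 - D) / 4 := by rw [← hss, hq]; ring
    rw [this, hD]
    field_simp
    ring
  have hq0 : 0 < q := by rw [hq]; linarith
  have hq1 : q ≤ 1 / 2 := by rw [hq]; linarith
  have hconv : ConvexOn ℝ (Set.Icc q (1 - q)) f := by
    apply convexOn_of_hasDerivWithinAt2_nonneg (convex_Icc _ _) hcont.continuousOn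
      (f' := fun x => Real.log (1 - x) - Real.log x - 4 * Real.log 2 * (1 - 2 * x))
      (f'' := fun x => 8 * Real.log 2 - 1 / (x * (1 - x)))
    · intro x hx
      rw [interior_Icc] at hx
      exact (hd1 x (by linarith [hx.1]) (by linarith [hx.2])).hasDerivWithinAt
    · intro x hx
      rw [interior_Icc] at hx
      exact (hd2 x (by linarith [hx.1]) (by linarith [hx.2])).hasDerivWithinAt
    · intro x hx
      rw [interior_Icc] at hx
      have hx0 : 0 < x * (1 - x) := mul_pos (by linarith [hx.1]) (by linarith [hx.2])
      have hge : q * (1 - q) ≤ x * (1 - x) := by nlinarith [hx.1, hx.2]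
      rw [sub_nonneg, div_le_iff₀ hx0]
      nlinarith
  have hconc : ConcaveOn ℝ (Set.Icc 0 q) f := by
    apply concaveOn_of_hasDerivWithinAt2_nonpos (convex_Icc _ _) hcont.continuousOn
      (f' := fun x => Real.log (1 - x) - Real.log x - 4 * Real.log 2 * (1 - 2 * x))
      (f'' := fun x => 8 * Real.log 2 - 1 / (x * (1 - x)))
    · intro x hx
      rw [interior_Icc] at hx
      exact (hd1 x (by linarith [hx.1]) (by linarith [hx.2])).hasDerivWithinAt
    · intro x hx
      rw [interior_Icc] at hx
      exact (hd2 x (by linarith [hx.1]) (by linarith [hx.2])).hasDerivWithinAt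
    · intro x hx
      rw [interior_Icc] at hx
      have hx0 : 0 < x * (1 - x) := mul_pos (by linarith [hx.1]) (by linarith [hx.2])
      have hge : x * (1 - x) ≤ q * (1 - q) := by nlinarith [hx.1, hx.2]
      rw [sub_nonpos, le_div_iff₀ hx0]
      nlinarith
  -- By symmetry and convexity, `f x` is at least the value `0` at the midpoint `1 / 2` of `x` and
  -- `1 - x`.
  have hmid : ∀ x ∈ Set.Icc q (1 - q), 0 ≤ f x := by
    intro x hx
    have hx' : 1 - x ∈ Set.Icc q (1 - q) := ⟨by linarith [hx.2], by linarith [hx.1]⟩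
    have h := hconv.2 hx hx' (by norm_num : (0 : ℝ) ≤ 1 / 2) (by norm_num : (0 : ℝ) ≤ 1 / 2)
      (by norm_num)
    have e : (1 / 2 : ℝ) • x + (1 / 2 : ℝ) • (1 - x) = 1 / 2 := by
      simp only [smul_eq_mul]; ring
    rw [e, hhalf, hsymm] at h
    simp only [smul_eq_mul] at h
    linarith
  -- A concave function is at least the smaller of its endpoint values, here `f 0 = 0` and `f q ≥
  -- 0`.
  have hleft : ∀ x ∈ Set.Icc 0 q, 0 ≤ f x := by
    intro x hx
    have h := hconc.min_le_of_mem_Icc (x := 0) (y := q) ⟨le_rfl, hq0.le⟩ ⟨hq0.le, le_rfl⟩ hx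
    refine le_trans (le_min ?_ (hmid q ⟨le_rfl, by linarith⟩)) h
    simp [hf]
  have key : 0 ≤ f p := by
    rcases le_total p q with hpq | hpq
    · exact hleft p ⟨h0, hpq⟩
    rcases le_total p (1 - q) with hpq' | hpq'
    · exact hmid p ⟨hpq, hpq'⟩
    · rw [← hsymm]
      exact hleft (1 - p) ⟨by linarith, by linarith⟩
  simpa [hf] using key

/-- At `p = (1 - √y) / 2` one has `4p(1-p) = 1 - y` exactly, so `p` lies in the set whose infimum
defines the inverse. -/
theorem binEntropyInv_le {y : ℝ} (hy0 : 0 ≤ y) (hy1 : y ≤ 1) :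
    binEntropyInv (1 - y) ≤ (1 - Real.sqrt y) / 2 := by
  have hlog : 0 < Real.log 2 := Real.log_pos one_lt_two
  have hs0 := Real.sqrt_nonneg y
  have hs1 : Real.sqrt y ≤ 1 := Real.sqrt_le_one.mpr hy1
  refine csInf_le ⟨0, fun p hp => hp.1⟩ ⟨by linarith, by linarith, ?_⟩
  have h := four_mul_log_two_mul_le_binEntropy (p := (1 - Real.sqrt y) / 2) (by linarith)
    (by linarith)
  rw [binEntropyBits, le_div_iff₀ hlog]
  refine le_trans (le_of_eq ?_) h
  have := Real.sq_sqrt hy0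
  linear_combination (Real.log 2) * this

/-! ### Low-degree polynomials on the Boolean cube and their second moments -/

section Cube

variable {V : Type*} [NormedAddCommGroup V] [InnerProductSpace ℂ V]

/-- The sign `(-1)^b`. -/
noncomputable def boolSign (b : Bool) : ℝ := if b then -1 else 1

theorem boolSign_mul_self (b : Bool) : boolSign b * boolSign b = 1 := by
  cases b <;> simp [boolSign]

theorem abs_boolSign (b : Bool) : |boolSign b| = 1 := by
  cases b <;> simp [boolSign]

/-- `DegLE n T g`: the function `g` on the Boolean cube `{0,1}^n` is a polynomial of degree at most
`T` in the signs of its arguments, with vector coefficients. -/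
def DegLE : (n : ℕ) → ℕ → ((Fin n → Bool) → V) → Prop
  | 0, _, _ => True
  | n + 1, 0, g => ∃ g₀ : (Fin n → Bool) → V, DegLE n 0 g₀ ∧ ∀ b x, g (Fin.cons b x) = g₀ x
  | n + 1, T + 1, g => ∃ g₀ g₁ : (Fin n → Bool) → V, DegLE n (T + 1) g₀ ∧ DegLE n T g₁ ∧
      ∀ b x, g (Fin.cons b x) = g₀ x + (boolSign b : ℂ) • g₁ x

theorem DegLE.const (n T : ℕ) (v : V) : DegLE n T fun _ => v := by
  have h0 : ∀ n T, DegLE n T fun _ => (0 : V) := by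
    intro n
    induction n with
    | zero => intro T; trivial
    | succ n ih =>
      intro T
      cases T with
      | zero => exact ⟨_, ih 0, fun _ _ => rfl⟩
      | succ T => exact ⟨_, _, ih (T + 1), ih T, fun b x => by simp⟩
  induction n generalizing T with
  | zero => trivial
  | succ n ih =>
    cases T with
    | zero => exact ⟨_, ih 0, fun _ _ => rfl⟩
    | succ T => exact ⟨_, _, ih (T + 1), h0 n T, fun b x => by simp⟩

theorem DegLE.add {n T : ℕ} {f g : (Fin n → Bool) → V} (hf : DegLE n T f) (hg : DegLE n T g) :
    DegLE n T fun x => f x + g x := by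
  induction n generalizing T with
  | zero => trivial
  | succ n ih =>
    cases T with
    | zero =>
      obtain ⟨f₀, hf₀, hf⟩ := hf
      obtain ⟨g₀, hg₀, hg⟩ := hg
      exact ⟨_, ih hf₀ hg₀, fun b x => by simp only [hf, hg]⟩
    | succ T =>
      obtain ⟨f₀, f₁, hf₀, hf₁, hf⟩ := hf
      obtain ⟨g₀, g₁, hg₀, hg₁, hg⟩ := hg
      exact ⟨_, _, ih hf₀ hg₀, ih hf₁ hg₁, fun b x => by simp only [hf, hg, smul_add]; abel⟩

theorem DegLE.sum {ι : Type*} (s : Finset ι) {n T : ℕ} {f : ι → (Fin n → Bool) → V}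
    (hf : ∀ i ∈ s, DegLE n T (f i)) : DegLE n T fun x => ∑ i ∈ s, f i x := by
  classical
  induction s using Finset.induction_on with
  | empty => simpa using DegLE.const n T (0 : V)
  | insert i s his ih =>
    simp only [Finset.sum_insert his]
    exact (hf i (Finset.mem_insert_self i s)).add
      (ih fun j hj => hf j (Finset.mem_insert_of_mem hj))

theorem DegLE.succ {n T : ℕ} {f : (Fin n → Bool) → V} (hf : DegLE n T f) : DegLE n (T + 1) f := by
  induction n generalizing T with
  | zero => trivial
  | succ n ih =>
    cases T with
    | zero =>
      obtain ⟨f₀, hf₀, hf⟩ := hf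
      exact ⟨_, _, ih hf₀, DegLE.const n 0 (0 : V), fun b x => by simp [hf]⟩
    | succ T =>
      obtain ⟨f₀, f₁, hf₀, hf₁, hf⟩ := hf
      exact ⟨_, _, ih hf₀, ih hf₁, hf⟩

theorem DegLE.smul {n T : ℕ} {f : (Fin n → Bool) → V} (hf : DegLE n T f) (c : ℂ) :
    DegLE n T fun x => c • f x := by
  induction n generalizing T with
  | zero => trivial
  | succ n ih =>
    cases T with
    | zero =>
      obtain ⟨f₀, hf₀, hf⟩ := hf
      exact ⟨_, ih hf₀, fun b x => by simp only [hf]⟩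
    | succ T =>
      obtain ⟨f₀, f₁, hf₀, hf₁, hf⟩ := hf
      exact ⟨_, _, ih hf₀, ih hf₁, fun b x => by
        simp only [hf, smul_add]
        rw [smul_comm c]⟩

theorem DegLE.sign_smul {n T : ℕ} {f : (Fin n → Bool) → V} (hf : DegLE n T f) (j : Fin n) :
    DegLE n (T + 1) fun x => (boolSign (x j) : ℂ) • f x := by
  induction n generalizing T with
  | zero => trivial
  | succ n ih =>
    cases T with
    | zero =>
      obtain ⟨f₀, hf₀, hf⟩ := hf
      refine Fin.cases ?_ (fun j => ?_) j
      · exact ⟨_, _, DegLE.const n 1 (0 : V), hf₀, fun b x => by simp [hf]⟩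
      · exact ⟨_, _, ih hf₀ j, DegLE.const n 0 (0 : V), fun b x => by simp [hf]⟩
    | succ T =>
      obtain ⟨f₀, f₁, hf₀, hf₁, hf⟩ := hf
      refine Fin.cases ?_ (fun j => ?_) j
      -- Since the sign squares to `1`, multiplying by the first sign swaps the two coefficients.
      · exact ⟨_, _, hf₁.succ.succ, hf₀, fun b x => by
          simp [hf, smul_add, smul_smul, boolSign_mul_self, add_comm]⟩
      · exact ⟨_, _, ih hf₀ j, ih hf₁ j, fun b x => by
          simp only [hf, Fin.cons_succ, smul_add]
          rw [smul_comm (boolSign b : ℂ)]⟩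

theorem sum_cube_succ {n : ℕ} (F : (Fin (n + 1) → Bool) → ℝ) :
    ∑ x, F x = ∑ x : Fin n → Bool, (F (Fin.cons true x) + F (Fin.cons false x)) := by
  rw [← (Fin.consEquiv fun _ => Bool).sum_comp, Fintype.sum_prod_type, Fintype.sum_bool,
    ← Finset.sum_add_distrib]
  rfl

/-- The linear form `∑ τⱼ (-1)^{xⱼ}` on the Boolean cube. -/
noncomputable def cubeLinear {n : ℕ} (τ : Fin n → ℝ) (x : Fin n → Bool) : ℝ :=
  ∑ j, τ j * boolSign (x j)

theorem cubeLinear_cons {n : ℕ} (τ : Fin (n + 1) → ℝ) (b : Bool) (x : Fin n → Bool) :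
    cubeLinear τ (Fin.cons b x) = τ 0 * boolSign b + cubeLinear (fun j => τ j.succ) x := by
  simp [cubeLinear, Fin.sum_univ_succ]

/-- A polynomial of degree `0` gives the uniform density up to scale, under which a linear form has
mean zero. -/
theorem DegLE.sum_normSq_mul_cubeLinear {n : ℕ} {g : (Fin n → Bool) → V} (hg : DegLE n 0 g)
    (τ : Fin n → ℝ) : ∑ x, ‖g x‖ ^ 2 * cubeLinear τ x = 0 := by
  induction n with
  | zero => simp [cubeLinear]
  | succ n ih =>
    obtain ⟨g₀, hg₀, h⟩ := hg
    rw [sum_cube_succ]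
    have : ∀ x : Fin n → Bool, ‖g (Fin.cons true x)‖ ^ 2 * cubeLinear τ (Fin.cons true x)
        + ‖g (Fin.cons false x)‖ ^ 2 * cubeLinear τ (Fin.cons false x)
        = 2 * (‖g₀ x‖ ^ 2 * cubeLinear (fun j => τ j.succ) x) := by
      intro x
      simp only [h, cubeLinear_cons, boolSign]
      simp
      ring
    simp only [this, ← Finset.mul_sum, ih hg₀, mul_zero]

/-- The constant in the bound on the second moment of a linear form under a polynomial density. -/
def momentConst : ℕ → ℝ
  | 0 => 1
  | T + 1 => 4 * T + 3

theorem momentConst_pos (T : ℕ) : 0 < momentConst T := by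
  cases T <;> simp only [momentConst] <;> positivity

theorem normSq_add_sub (a b : V) :
    ‖a + b‖ ^ 2 + ‖a - b‖ ^ 2 = 2 * (‖a‖ ^ 2 + ‖b‖ ^ 2) := by
  have := parallelogram_law_with_norm ℂ a b
  nlinarith

theorem abs_normSq_add_sub_le (a b : V) :
    |‖a + b‖ ^ 2 - ‖a - b‖ ^ 2| ≤ 4 * (‖a‖ * ‖b‖) := by
  rw [@norm_add_sq ℂ, @norm_sub_sq ℂ]
  have h := (abs_le.mp ((Complex.abs_re_le_norm _).trans (norm_inner_le_norm (𝕜 := ℂ) a b)))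
  simp only [RCLike.re_to_complex]
  rw [abs_le]
  constructor <;> nlinarith [h.1, h.2]

/-- Inductive step in one bit, with `a` and `b` the even and odd parts. Only the cross term couples
them. It is at most `4 |y| ‖a‖ ‖b‖` up to a factor `2`, and is split by a weighted AM-GM inequality
with free weight `lam`. -/
theorem normSq_mul_sq_add_le (a b : V) {t : ℝ} (ht : |t| ≤ 1) (y : ℝ) {lam : ℝ} (hlam : 0 < lam) :
    ‖a - b‖ ^ 2 * (-t + y) ^ 2 + ‖a + b‖ ^ 2 * (t + y) ^ 2
      ≤ 2 * ((‖a‖ ^ 2 * y ^ 2 + (1 + 2 * lam) * ‖a‖ ^ 2)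
        + ((1 + 2 / lam) * (‖b‖ ^ 2 * y ^ 2) + ‖b‖ ^ 2)) := by
  have h1 := normSq_add_sub a b
  have h2 := abs_normSq_add_sub_le a b
  have ht2 : t ^ 2 ≤ 1 := by rw [← sq_abs]; nlinarith [abs_nonneg t]
  have e : ‖a - b‖ ^ 2 * (-t + y) ^ 2 + ‖a + b‖ ^ 2 * (t + y) ^ 2
      = 2 * (y ^ 2 + t ^ 2) * (‖a‖ ^ 2 + ‖b‖ ^ 2)
        + 2 * (t * y * (‖a + b‖ ^ 2 - ‖a - b‖ ^ 2)) := by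
    linear_combination (y ^ 2 + t ^ 2) * h1
  have h3 : t * y * (‖a + b‖ ^ 2 - ‖a - b‖ ^ 2) ≤ |y| * (4 * (‖a‖ * ‖b‖)) := by
    refine (le_abs_self _).trans ?_
    rw [abs_mul, abs_mul]
    refine mul_le_mul ?_ h2 (abs_nonneg _) (abs_nonneg _)
    nlinarith [abs_nonneg y]
  have h4 : |y| * (4 * (‖a‖ * ‖b‖)) ≤ 2 * lam * ‖a‖ ^ 2 + 2 / lam * (‖b‖ ^ 2 * y ^ 2) := by
    have h5 : 0 ≤ 2 / lam * (lam * ‖a‖ - ‖b‖ * |y|) ^ 2 := by positivity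
    have h6 : 2 / lam * (lam * ‖a‖ - ‖b‖ * |y|) ^ 2
        = 2 * lam * ‖a‖ ^ 2 + 2 / lam * (‖b‖ ^ 2 * y ^ 2) - |y| * (4 * (‖a‖ * ‖b‖)) := by
      rw [← sq_abs y]
      field_simp
      ring
    linarith
  rw [e]
  nlinarith [sq_nonneg ‖a‖, sq_nonneg ‖b‖, mul_le_mul_of_nonneg_right ht2 (sq_nonneg ‖a‖),
    mul_le_mul_of_nonneg_right ht2 (sq_nonneg ‖b‖)]

/-- Second moment of a linear form on the cube, when the density is the squared norm of a
polynomial of degree at most `T`. -/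
theorem DegLE.sum_normSq_mul_cubeLinear_sq_le {n T : ℕ} {g : (Fin n → Bool) → V}
    (hg : DegLE n T g) (τ : Fin n → ℝ) (hτ : ∀ j, |τ j| ≤ 1) :
    ∑ x, ‖g x‖ ^ 2 * cubeLinear τ x ^ 2 ≤ momentConst T * n * ∑ x, ‖g x‖ ^ 2 := by
  induction n generalizing T with
  | zero => simp [cubeLinear]
  | succ n ih =>
    rw [sum_cube_succ, sum_cube_succ]
    simp only [cubeLinear_cons]
    set τ' : Fin n → ℝ := fun j => τ j.succ
    have hτ' : ∀ j, |τ' j| ≤ 1 := fun j => hτ _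
    have ht2 : τ 0 ^ 2 ≤ 1 := by rw [← sq_abs]; nlinarith [abs_nonneg (τ 0), hτ 0]
    cases T with
    | zero =>
      obtain ⟨g₀, hg₀, h⟩ := hg
      have hi := ih hg₀ τ' hτ'
      simp only [h, momentConst, one_mul] at hi ⊢
      calc ∑ x, (‖g₀ x‖ ^ 2 * (τ 0 * boolSign true + cubeLinear τ' x) ^ 2
            + ‖g₀ x‖ ^ 2 * (τ 0 * boolSign false + cubeLinear τ' x) ^ 2)
          ≤ ∑ x, (2 * (‖g₀ x‖ ^ 2 * cubeLinear τ' x ^ 2) + 2 * ‖g₀ x‖ ^ 2) := by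
            refine Finset.sum_le_sum fun x _ => ?_
            simp only [boolSign]
            simp
            nlinarith [sq_nonneg ‖g₀ x‖, mul_le_mul_of_nonneg_left ht2 (sq_nonneg ‖g₀ x‖)]
        _ ≤ _ := by
            rw [Finset.sum_add_distrib, ← Finset.mul_sum, ← Finset.mul_sum, Finset.sum_add_distrib]
            push_cast
            nlinarith
    | succ T =>
      obtain ⟨g₀, g₁, hg₀, hg₁, h⟩ := hg
      have hi₀ := ih hg₀ τ' hτ'
      have hi₁ := ih hg₁ τ' hτ'
      -- With weight `2T + 1`, the coefficient `1 + 2 (2T + 1)` of the even part equals `momentConst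
      -- (T + 1)`. The factor `1 + 2 / (2T + 1)` on the odd part is affordable because that part has
      -- degree only `T`.
      have hlam : (0 : ℝ) < 2 * T + 1 := by positivity
      have eR : ∑ x, (‖g (Fin.cons true x)‖ ^ 2 + ‖g (Fin.cons false x)‖ ^ 2)
          = 2 * (∑ x, ‖g₀ x‖ ^ 2 + ∑ x, ‖g₁ x‖ ^ 2) := by
        rw [← Finset.sum_add_distrib, Finset.mul_sum]
        refine Finset.sum_congr rfl fun x _ => ?_
        rw [← normSq_add_sub, h, h]
        simp only [boolSign]
        simp [sub_eq_add_neg, add_comm]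
      have eL : ∑ x, (‖g (Fin.cons true x)‖ ^ 2 * (τ 0 * boolSign true + cubeLinear τ' x) ^ 2
            + ‖g (Fin.cons false x)‖ ^ 2 * (τ 0 * boolSign false + cubeLinear τ' x) ^ 2)
          ≤ 2 * ((∑ x, ‖g₀ x‖ ^ 2 * cubeLinear τ' x ^ 2
                + (1 + 2 * (2 * T + 1)) * ∑ x, ‖g₀ x‖ ^ 2)
              + ((1 + 2 / (2 * T + 1)) * ∑ x, ‖g₁ x‖ ^ 2 * cubeLinear τ' x ^ 2
                + ∑ x, ‖g₁ x‖ ^ 2)) := by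
        rw [Finset.mul_sum, Finset.mul_sum, ← Finset.sum_add_distrib, ← Finset.sum_add_distrib,
          ← Finset.sum_add_distrib, Finset.mul_sum]
        refine Finset.sum_le_sum fun x _ => ?_
        have := normSq_mul_sq_add_le (g₀ x) (g₁ x) (hτ 0) (cubeLinear τ' x) hlam
        simpa [h, boolSign, sub_eq_add_neg] using this
      rw [eR]
      refine eL.trans ?_
      set A := ∑ x, ‖g₀ x‖ ^ 2
      set B := ∑ x, ‖g₁ x‖ ^ 2
      have hA : 0 ≤ A := Finset.sum_nonneg fun _ _ => by positivity
      have hB : 0 ≤ B := Finset.sum_nonneg fun _ _ => by positivity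
      have hn : (0 : ℝ) ≤ n := Nat.cast_nonneg n
      have hc : momentConst T * (1 + 2 / (2 * T + 1)) ≤ momentConst (T + 1) := by
        cases T with
        | zero => simp [momentConst]; norm_num
        | succ T =>
          simp only [momentConst]
          push_cast
          have hp : (0 : ℝ) < 2 * (T + 1) + 1 := by positivity
          rw [show (1 : ℝ) + 2 / (2 * (T + 1) + 1) = (2 * T + 5) / (2 * (T + 1) + 1) by
            field_simp; ring, mul_div_assoc', div_le_iff₀ hp]
          have : (0 : ℝ) ≤ T := Nat.cast_nonneg T
          nlinarith
      have hone : 1 ≤ momentConst (T + 1) := by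
        simp only [momentConst]
        have : (0 : ℝ) ≤ T := Nat.cast_nonneg T
        linarith
      have h1 : (1 + 2 / (2 * (T : ℝ) + 1)) * ∑ x, ‖g₁ x‖ ^ 2 * cubeLinear τ' x ^ 2
          ≤ momentConst (T + 1) * n * B := by
        calc _ ≤ (1 + 2 / (2 * (T : ℝ) + 1)) * (momentConst T * n * B) :=
              mul_le_mul_of_nonneg_left hi₁ (by positivity)
          _ = momentConst T * (1 + 2 / (2 * T + 1)) * (n * B) := by ring
          _ ≤ momentConst (T + 1) * (n * B) :=
              mul_le_mul_of_nonneg_right hc (by positivity)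
          _ = _ := by ring
      have h2 : (1 + 2 * (2 * (T : ℝ) + 1)) * A = momentConst (T + 1) * A := by
        simp only [momentConst]; ring
      have h3 : B ≤ momentConst (T + 1) * B := le_mul_of_one_le_left hB hone
      rw [h2]
      push_cast
      linarith

end Cube

/-! ### Second moments of affine forms -/

section Moments

variable {V : Type*} [NormedAddCommGroup V] [InnerProductSpace ℂ V]

theorem abs_cubeLinear_le {n : ℕ} {τ : Fin n → ℝ} (hτ : ∀ j, |τ j| ≤ 1) (x : Fin n → Bool) :
    |cubeLinear τ x| ≤ n := by
  refine (Finset.abs_sum_le_sum_abs _ _).trans ?_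
  refine (Finset.sum_le_card_nsmul _ _ 1 fun j _ => ?_).trans (by simp)
  rw [abs_mul, abs_boolSign, mul_one]
  exact hτ j

theorem DegLE.sum_normSq_mul_affine_sq_le_of_deg_zero {n : ℕ} {g : (Fin n → Bool) → V}
    (hg : DegLE n 0 g) {τ : Fin n → ℝ} (hτ : ∀ j, |τ j| ≤ 1) {R r : ℝ} (hR : |R| ≤ r) :
    ∑ x, ‖g x‖ ^ 2 * (R + cubeLinear τ x) ^ 2 ≤ (r ^ 2 + n) * ∑ x, ‖g x‖ ^ 2 := by
  have h1 := hg.sum_normSq_mul_cubeLinear τ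
  have h2 := hg.sum_normSq_mul_cubeLinear_sq_le τ hτ
  have hA : 0 ≤ ∑ x, ‖g x‖ ^ 2 := Finset.sum_nonneg fun _ _ => by positivity
  have hR2 : R ^ 2 ≤ r ^ 2 := sq_le_sq' (by linarith [neg_abs_le R]) ((le_abs_self R).trans hR)
  calc ∑ x, ‖g x‖ ^ 2 * (R + cubeLinear τ x) ^ 2
      = R ^ 2 * ∑ x, ‖g x‖ ^ 2 + 2 * R * ∑ x, ‖g x‖ ^ 2 * cubeLinear τ x
        + ∑ x, ‖g x‖ ^ 2 * cubeLinear τ x ^ 2 := by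
        rw [Finset.mul_sum, Finset.mul_sum, ← Finset.sum_add_distrib, ← Finset.sum_add_distrib]
        exact Finset.sum_congr rfl fun x _ => by ring
    _ ≤ _ := by
        rw [h1]
        simp only [momentConst] at h2
        nlinarith [mul_le_mul_of_nonneg_right hR2 hA]

theorem DegLE.sum_normSq_mul_affine_sq_le {n T : ℕ} (hn : 0 < n) {g : (Fin n → Bool) → V}
    (hg : DegLE n T g) {τ : Fin n → ℝ} (hτ : ∀ j, |τ j| ≤ 1) {R r : ℝ} (hR : |R| ≤ r) :
    ∑ x, ‖g x‖ ^ 2 * (R + cubeLinear τ x) ^ 2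
      ≤ (r + Real.sqrt (momentConst T * n)) ^ 2 * ∑ x, ‖g x‖ ^ 2 := by
  have h2 := hg.sum_normSq_mul_cubeLinear_sq_le τ hτ
  have hA : 0 ≤ ∑ x, ‖g x‖ ^ 2 := Finset.sum_nonneg fun _ _ => by positivity
  have hr : 0 ≤ r := (abs_nonneg R).trans hR
  have hcn : 0 < momentConst T * n := mul_pos (momentConst_pos T) (by exact_mod_cast hn)
  set y := Real.sqrt (momentConst T * n) with hy
  have hy0 : 0 < y := Real.sqrt_pos.mpr hcn
  have hyy : y ^ 2 = momentConst T * n := Real.sq_sqrt hcn.le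
  -- The AM-GM weight is tuned so that a second moment `y ^ 2` of `z` gives exactly `(r + y) ^ 2`.
  have hpt : ∀ z : ℝ, (R + z) ^ 2 ≤ r ^ 2 + r * y + (1 + r / y) * z ^ 2 := by
    intro z
    have e1 : R ^ 2 ≤ r ^ 2 := sq_le_sq' (by linarith [neg_abs_le R]) ((le_abs_self R).trans hR)
    have e2 : R * z ≤ r * |z| := by
      refine (le_abs_self _).trans ?_
      rw [abs_mul]
      exact mul_le_mul_of_nonneg_right hR (abs_nonneg _)
    have e3 : 2 * (r * |z|) ≤ r * y + r / y * z ^ 2 := by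
      have h5 : 0 ≤ r / y * (y - |z|) ^ 2 := by positivity
      have h6 : r / y * (y - |z|) ^ 2 = r * y + r / y * z ^ 2 - 2 * (r * |z|) := by
        rw [← sq_abs z]
        field_simp
        ring
      linarith
    nlinarith
  calc ∑ x, ‖g x‖ ^ 2 * (R + cubeLinear τ x) ^ 2
      ≤ ∑ x, ((r ^ 2 + r * y) * ‖g x‖ ^ 2
        + (1 + r / y) * (‖g x‖ ^ 2 * cubeLinear τ x ^ 2)) := by
        refine Finset.sum_le_sum fun x _ => ?_
        have := mul_le_mul_of_nonneg_left (hpt (cubeLinear τ x)) (sq_nonneg ‖g x‖)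
        linarith
    _ = (r ^ 2 + r * y) * ∑ x, ‖g x‖ ^ 2
        + (1 + r / y) * ∑ x, ‖g x‖ ^ 2 * cubeLinear τ x ^ 2 := by
        rw [Finset.sum_add_distrib, ← Finset.mul_sum, ← Finset.mul_sum]
    _ ≤ (r ^ 2 + r * y) * ∑ x, ‖g x‖ ^ 2 + (1 + r / y) * (y ^ 2 * ∑ x, ‖g x‖ ^ 2) := by
        rw [hyy]
        gcongr
    _ = _ := by
        field_simp
        ring

end Moments

/-! ### Comparison of the moment bound with `p₁` -/

section Parameters

theorem p1Param_eq {α : ℝ} {d n T : ℕ} (hn : (n : ℝ) = α * d) (hn0 : 0 < n) (hnd : n < d) :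
    p1Param α d T = (((d : ℝ) - n - 2 * n * binEntropyInv (1 - T * Real.logb 2 d / n)) ^ 2
      + Real.sqrt (8 / 3) * Real.sqrt n * ((d : ℝ) - n)) / (d * ((d : ℝ) - n)) := by
  have hd : (0 : ℝ) < d := by exact_mod_cast hn0.trans hnd
  have hnd' : (0 : ℝ) < (d : ℝ) - n := by rw [sub_pos]; exact_mod_cast hnd
  have hn' : (0 : ℝ) < n := by exact_mod_cast hn0
  have hα : α = n / d := by rw [hn]; field_simp
  have h1 : 1 - α = ((d : ℝ) - n) / d := by rw [hα]; field_simp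
  have h2 : phiParam d T / α = T * Real.logb 2 d / n := by
    rw [phiParam, hα]; field_simp
  rw [p1Param, h2, ← hn, h1, hα]
  field_simp

theorem binEntropyInv_nonneg (y : ℝ) : 0 ≤ binEntropyInv y :=
  Real.sInf_nonneg fun _ hp => hp.1

/-- For `T ≥ 1` the first alternative reads `4T - 1 ≤ T log₂ d`, immediate for `d ≥ 16`. For `8 ≤ d
< 16`, the hypothesis `T log₂ d ≤ n ≤ 7` leaves `T ≤ 2`; if `T = 2` then `d ≥ 12`, and `2 ^ 7 ≤ 12 ^
2`. For `d < 8` the constant `5 / 6` comes from `n = 3`, where `2 ^ 5 ≤ 6 ^ 2`. -/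
theorem momentConst_le_or_small {d n T : ℕ} (hn0 : 0 < n) (hnd : n ∣ d) (h2n : 2 * n ≤ d)
    (hT : 0 < T) (hTL : T * Real.logb 2 d ≤ n) :
    momentConst T ≤ T * Real.logb 2 d ∨ (n ≤ 3 ∧ (5 / 6 : ℝ) * n ≤ T * Real.logb 2 d) := by
  have hd0 : (0 : ℝ) < d := by exact_mod_cast (by omega : 0 < d)
  have hlog : ∀ a b : ℕ, 0 < b → 2 ^ a ≤ d ^ b → (a : ℝ) ≤ b * Real.logb 2 d := by
    intro a b hb h
    rw [← Real.logb_pow, Real.le_logb_iff_rpow_le one_lt_two (by positivity)]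
    rw [Real.rpow_natCast]
    exact_mod_cast h
  have hT1 : (1 : ℝ) ≤ T := by exact_mod_cast hT
  obtain ⟨T, rfl⟩ : ∃ T', T = T' + 1 := ⟨T - 1, by omega⟩
  have hL0 : 0 ≤ Real.logb 2 d := by
    have := hlog 0 1 one_pos (by simp; omega)
    simpa using this
  have hLT : Real.logb 2 d ≤ (T + 1 : ℕ) * Real.logb 2 d := le_mul_of_one_le_left hL0 hT1
  rcases Nat.lt_or_ge d 8 with hd8 | hd8
  · right
    have hn3 : n ≤ 3 := by omega
    refine ⟨hn3, le_trans ?_ hLT⟩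
    interval_cases n
    · have := hlog 1 1 one_pos (by simpa using h2n)
      push_cast at this ⊢
      linarith
    · have := hlog 2 1 one_pos (by simpa using h2n)
      push_cast at this ⊢
      linarith
    · have := hlog 5 2 two_pos ((by norm_num : 2 ^ 5 ≤ 6 ^ 2).trans (Nat.pow_le_pow_left h2n 2))
      push_cast at this ⊢
      linarith
  left
  have hL3 := hlog 3 1 one_pos (by simpa using hd8)
  simp only [momentConst]
  push_cast at hL3 hTL ⊢
  rcases Nat.lt_or_ge d 16 with hd16 | hd16
  · have hn8 : n < 8 := by omega
    have hn7 : (n : ℝ) ≤ 7 := by exact_mod_cast (by omega : n ≤ 7)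
    have hT2 : (T : ℝ) < 2 := by nlinarith
    have hT2' : T < 2 := by exact_mod_cast hT2
    interval_cases T
    · norm_num at hL3 ⊢
      linarith
    · norm_num at hL3 hTL ⊢
      have h6 : (6 : ℝ) ≤ n := by linarith
      have h6' : 6 ≤ n := by exact_mod_cast h6
      have := hlog 7 2 two_pos
        ((by norm_num : 2 ^ 7 ≤ 12 ^ 2).trans (Nat.pow_le_pow_left (by omega) 2))
      push_cast at this
      linarith
  · have hL4 := hlog 4 1 one_pos (by simpa using hd16)
    push_cast at hL4
    have : (0 : ℝ) ≤ T := Nat.cast_nonneg T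
    nlinarith

/-- At one position, a forger whose knowledge is a polynomial of degree at most `T` in the hidden
bits passes the test with probability at most `p₁`. -/
theorem DegLE.sum_normSq_mul_pass_le {V : Type*} [NormedAddCommGroup V] [InnerProductSpace ℂ V]
    {α : ℝ} {d n T : ℕ} (hn : (n : ℝ) = α * d) (hn0 : 0 < n) (hnd : n ∣ d) (h2n : 2 * n ≤ d)
    (hφ : phiParam d T ≤ α) {g : (Fin n → Bool) → V} (hg : DegLE n T g) {τ : Fin n → ℝ}
    (hτ : ∀ j, |τ j| ≤ 1) {R : ℝ} (hR : |R| ≤ (d : ℝ) - 2 * n) :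
    ∑ x, ‖g x‖ ^ 2 * ((R + cubeLinear τ x) ^ 2 / (d * ((d : ℝ) - n)))
      ≤ p1Param α d T * ∑ x, ‖g x‖ ^ 2 := by
  have hdn : n < d := by omega
  have hd : (0 : ℝ) < d := by exact_mod_cast hn0.trans hdn
  have hn' : (0 : ℝ) < n := by exact_mod_cast hn0
  have hn1 : (1 : ℝ) ≤ n := by exact_mod_cast hn0
  have h2n' : 2 * (n : ℝ) ≤ d := by exact_mod_cast h2n
  have hl : (0 : ℝ) < (d : ℝ) - n := by linarith
  have hA : 0 ≤ ∑ x, ‖g x‖ ^ 2 := Finset.sum_nonneg fun _ _ => by positivity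
  have hTL : T * Real.logb 2 d ≤ n := by
    rw [phiParam, div_le_iff₀ hd] at hφ
    rw [hn]; exact hφ
  have hL0 : 0 ≤ Real.logb 2 d := by
    apply Real.logb_nonneg one_lt_two
    exact_mod_cast (by omega : 1 ≤ d)
  set y := T * Real.logb 2 d / n with hy
  have hy0 : 0 ≤ y := by positivity
  have hy1 : y ≤ 1 := by rw [hy, div_le_one hn']; exact hTL
  have hη := binEntropyInv_le hy0 hy1
  have hsy := Real.sqrt_nonneg y
  have hη0 := binEntropyInv_nonneg (1 - y)
  rw [p1Param_eq hn hn0 hdn, ← hy]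
  set η := binEntropyInv (1 - y)
  have hsn : Real.sqrt n ^ 2 = n := Real.sq_sqrt hn'.le
  have hsn0 : 0 < Real.sqrt n := Real.sqrt_pos.mpr hn'
  have hs83 : 1 ≤ Real.sqrt (8 / 3) := by
    rw [Real.one_le_sqrt]; norm_num
  suffices h : ∑ x, ‖g x‖ ^ 2 * (R + cubeLinear τ x) ^ 2
      ≤ (((d : ℝ) - n - 2 * n * η) ^ 2 + Real.sqrt (8 / 3) * Real.sqrt n * ((d : ℝ) - n))
        * ∑ x, ‖g x‖ ^ 2 by
    have e : ∑ x, ‖g x‖ ^ 2 * ((R + cubeLinear τ x) ^ 2 / (d * ((d : ℝ) - n)))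
        = (∑ x, ‖g x‖ ^ 2 * (R + cubeLinear τ x) ^ 2) / (d * ((d : ℝ) - n)) := by
      rw [Finset.sum_div]
      exact Finset.sum_congr rfl fun x _ => by rw [mul_div_assoc]
    rw [e, div_mul_eq_mul_div]
    exact div_le_div_of_nonneg_right h (by positivity)
  rcases Nat.eq_zero_or_pos T with rfl | hT
  -- Without copies there is no cross term, and the extra `n` is absorbed by the additive term of
  -- `p₁`.
  · refine (hg.sum_normSq_mul_affine_sq_le_of_deg_zero hτ hR).trans
      (mul_le_mul_of_nonneg_right ?_ hA)
    have h1 : ((d : ℝ) - 2 * n) ^ 2 ≤ ((d : ℝ) - n - 2 * n * η) ^ 2 := by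
      apply pow_le_pow_left₀ (by linarith)
      nlinarith
    have h2 : Real.sqrt n ≤ (d : ℝ) - n := by nlinarith
    nlinarith [mul_le_mul_of_nonneg_left h2 hsn0.le, mul_pos hsn0 hl]
  rcases momentConst_le_or_small hn0 hnd h2n hT hTL with hc | ⟨hn3, hc⟩
  · refine (hg.sum_normSq_mul_affine_sq_le hn0 hτ hR).trans (mul_le_mul_of_nonneg_right ?_ hA)
    have h1 : Real.sqrt (momentConst T * n) ≤ n * Real.sqrt y := by
      apply Real.sqrt_le_iff.mpr ⟨by positivity, ?_⟩
      rw [mul_pow, Real.sq_sqrt hy0, hy]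
      calc momentConst T * n ≤ T * Real.logb 2 d * n := mul_le_mul_of_nonneg_right hc hn'.le
        _ = _ := by field_simp
    have h2 : ((d : ℝ) - 2 * n + Real.sqrt (momentConst T * n)) ^ 2
        -- `2η ≤ 1 - √y` gives `d - 2n + n √y ≤ d - n - 2nη`.
        ≤ ((d : ℝ) - n - 2 * n * η) ^ 2 := by
      apply pow_le_pow_left₀ (add_nonneg (by linarith) (Real.sqrt_nonneg _))
      nlinarith
    have : 0 ≤ Real.sqrt (8 / 3) * Real.sqrt n * ((d : ℝ) - n) := by positivity
    linarith
  -- Here the trivial bound suffices: `y ≥ 5 / 6` forces `η ≤ 1 / 12`, so the additive term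
  -- outweighs the loss `4nη (d - n)` in the square.
  · have hbd : ∀ x, (R + cubeLinear τ x) ^ 2 ≤ ((d : ℝ) - n) ^ 2 := by
      intro x
      have := abs_cubeLinear_le hτ x
      rw [abs_le] at this hR
      apply sq_le_sq' <;> linarith [this.1, this.2, hR.1, hR.2]
    calc _ ≤ ∑ x, ‖g x‖ ^ 2 * ((d : ℝ) - n) ^ 2 :=
          Finset.sum_le_sum fun x _ => mul_le_mul_of_nonneg_left (hbd x) (sq_nonneg _)
      _ = ((d : ℝ) - n) ^ 2 * ∑ x, ‖g x‖ ^ 2 := by rw [← Finset.sum_mul, mul_comm]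
      _ ≤ _ := mul_le_mul_of_nonneg_right ?_ hA
    have hy56 : 5 / 6 ≤ y := by rw [hy, le_div_iff₀ hn']; exact hc
    have hsy56 : 5 / 6 ≤ Real.sqrt y := by
      apply Real.le_sqrt_of_sq_le
      norm_num
      linarith
    have hη12 : η ≤ 1 / 12 := by linarith
    have hn3' : (n : ℝ) ≤ 3 := by exact_mod_cast hn3
    have hsn2 : Real.sqrt n ≤ 2 := by nlinarith
    have h4 : 4 * n * η ≤ Real.sqrt (8 / 3) * Real.sqrt n := by nlinarith
    nlinarith [mul_le_mul_of_nonneg_right h4 hl.le, sq_nonneg (n * η)]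

end Parameters

/-! ### The test vectors and single-position pass probabilities -/

section TestVectors

variable {d S : ℕ}

theorem card_hiddenSet (s : Fin S) : (hiddenSet d S s).card = d / S := by
  have h1 : (hiddenSet d S s)ᶜ = Finset.univ.map ⟨revealedPos d S s,
      (revealedPos_strictMono d S s).injective⟩ := by
    ext a
    have := Set.ext_iff.mp (range_revealedPos d S s) a
    simp only [Set.mem_range, Set.mem_ofPred_eq] at this
    simp [this]
  have h2 := Finset.card_compl (hiddenSet d S s)
  rw [h1, Finset.card_map, Finset.card_univ, Fintype.card_fin, Fintype.card_fin] at h2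
  have h3 : (hiddenSet d S s).card ≤ d := by
    simpa using Finset.card_le_univ (hiddenSet d S s)
  have h4 : d / S ≤ d := Nat.div_le_self d S
  omega

theorem exists_revealedPos_of_notMem {s : Fin S} {a : Fin d} (ha : a ∉ hiddenSet d S s) :
    ∃ j, revealedPos d S s j = a := by
  have := Set.ext_iff.mp (range_revealedPos d S s) a
  exact this.mpr ha

theorem revealedPos_notMem (s : Fin S) (j : Fin (d - d / S)) :
    revealedPos d S s j ∉ hiddenSet d S s := by
  have := Set.ext_iff.mp (range_revealedPos d S s) (revealedPos d S s j)
  exact this.mp ⟨j, rfl⟩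

theorem disjoint_hiddenSet {s s' : Fin S} (h : s ≠ s') :
    Disjoint (hiddenSet d S s) (hiddenSet d S s') := by
  have aux : ∀ s s' : ℕ, s < s' → ∀ j n : ℕ, j < (s + 1) * n → s' * n ≤ j → False := by
    intro s s' hs j n h1 h2
    have : (s + 1) * n ≤ s' * n := Nat.mul_le_mul_right n hs
    omega
  rw [Finset.disjoint_left]
  intro a h1 h2
  simp only [hiddenSet, Finset.mem_filter] at h1 h2
  rcases lt_or_gt_of_ne (Fin.val_ne_of_ne h) with hlt | hlt
  · exact aux _ _ hlt _ _ h1.2.2 h2.2.1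
  · exact aux _ _ hlt _ _ h2.2.2 h1.2.1

open Classical in
/-- The signs of the revealed bits, with the value `0` at the hidden positions. -/
noncomputable def revealedSign (s : Fin S) (κ : Fin (d - d / S) → Bool) (a : Fin d) : ℝ :=
  if h : ∃ j, revealedPos d S s j = a then boolSign (κ h.choose) else 0

theorem revealedSign_revealedPos (s : Fin S) (κ : Fin (d - d / S) → Bool)
    (j : Fin (d - d / S)) : revealedSign s κ (revealedPos d S s j) = boolSign (κ j) := by
  have h : ∃ i, revealedPos d S s i = revealedPos d S s j := ⟨j, rfl⟩
  rw [revealedSign, dif_pos h, (revealedPos_strictMono d S s).injective h.choose_spec]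

theorem revealedSign_of_mem {s : Fin S} (κ : Fin (d - d / S) → Bool) {a : Fin d}
    (ha : a ∈ hiddenSet d S s) : revealedSign s κ a = 0 := by
  rw [revealedSign, dif_neg]
  rintro ⟨j, rfl⟩
  exact revealedPos_notMem s j ha

theorem abs_revealedSign_le (s : Fin S) (κ : Fin (d - d / S) → Bool) (a : Fin d) :
    |revealedSign s κ a| ≤ 1 := by
  rw [revealedSign]
  split_ifs
  · exact (abs_boolSign _).le
  · simp

theorem sum_eq_sum_revealedPos {M : Type*} [AddCommMonoid M] (s : Fin S) (f : Fin d → M)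
    (hf : ∀ a ∈ hiddenSet d S s, f a = 0) : ∑ a, f a = ∑ j, f (revealedPos d S s j) := by
  refine (Fintype.sum_of_injective (revealedPos d S s) (revealedPos_strictMono d S s).injective
    (fun j => f (revealedPos d S s j)) f (fun a ha => hf a ?_) fun _ => rfl).symm
  by_contra h
  exact ha (exists_revealedPos_of_notMem h)

theorem fingerprint_apply (x : Fin d → Bool) (a : Fin d) :
    fingerprint x a = (((Real.sqrt d)⁻¹ * boolSign (x a) : ℝ) : ℂ) := by
  simp only [fingerprint, boolSign]
  split_ifs <;> simp

/-- At a hidden position, flipping that bit pairs the consistent strings with opposite amplitudes.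
At a revealed position all of them agree. -/
theorem sum_consistent_fingerprint_apply (s : Fin S) (κ : Fin (d - d / S) → Bool) (a : Fin d) :
    (∑ k ∈ Finset.univ.filter (fun k : Fin d → Bool => revealedSubstring k s = κ),
        fingerprint k) a
      = (((Finset.univ.filter (fun k : Fin d → Bool => revealedSubstring k s = κ)).card
          * (Real.sqrt d)⁻¹ * revealedSign s κ a : ℝ) : ℂ) := by
  classical
  rw [WithLp.ofLp_sum, Finset.sum_apply]
  simp only [fingerprint_apply]
  rw [← Complex.ofReal_sum]
  congr 1
  by_cases ha : a ∈ hiddenSet d S s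
  · rw [revealedSign_of_mem κ ha, mul_zero]
    refine Finset.sum_involution (fun k _ => Function.update k a (!k a)) ?_ ?_ ?_ ?_
    · intro k _
      rw [Function.update_self]
      cases k a <;> simp [boolSign]
    · intro k _ _ h
      have := congrFun h a
      simp at this
    · intro k hk
      simp only [Finset.mem_filter, Finset.mem_univ, true_and] at hk ⊢
      rw [← hk]
      funext j
      simp only [revealedSubstring]
      rw [Function.update_of_ne]
      rintro rfl
      exact revealedPos_notMem s j ha
    · intro k _
      simp
  · obtain ⟨j, rfl⟩ := exists_revealedPos_of_notMem ha
    rw [revealedSign_revealedPos, mul_assoc, ← nsmul_eq_mul]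
    apply Finset.sum_eq_card_nsmul
    intro k hk
    simp only [Finset.mem_filter, Finset.mem_univ, true_and] at hk
    rw [← hk]
    rfl

theorem consistent_nonempty (s : Fin S) (κ : Fin (d - d / S) → Bool) :
    (Finset.univ.filter (fun k : Fin d → Bool => revealedSubstring k s = κ)).Nonempty := by
  refine ⟨Function.extend (revealedPos d S s) κ fun _ => false, ?_⟩
  simp only [Finset.mem_filter, Finset.mem_univ, true_and]
  funext j
  exact (revealedPos_strictMono d S s).injective.extend_apply _ _ _

theorem sum_revealedSign_sq (s : Fin S) (κ : Fin (d - d / S) → Bool) :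
    ∑ a, revealedSign s κ a ^ 2 = ((d - d / S : ℕ) : ℝ) := by
  rw [sum_eq_sum_revealedPos s _ fun a ha => by rw [revealedSign_of_mem κ ha]; norm_num]
  simp [revealedSign_revealedPos, sq, boolSign_mul_self]

theorem testVector_apply (hd : 0 < d) (s : Fin S) (κ : Fin (d - d / S) → Bool) (a : Fin d) :
    testVector s κ a
      = (((Real.sqrt ((d - d / S : ℕ) : ℝ))⁻¹ * revealedSign s κ a : ℝ) : ℂ) := by
  set C : ℝ := (Finset.univ.filter
    (fun k : Fin d → Bool => revealedSubstring k s = κ)).card * (Real.sqrt d)⁻¹ with hC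
  have hC0 : 0 < C := by
    have h1 : (0 : ℝ) < d := by exact_mod_cast hd
    have h2 := Finset.card_pos.mpr (consistent_nonempty s κ)
    positivity
  simp only [testVector]
  rw [PiLp.smul_apply, sum_consistent_fingerprint_apply, ← hC, EuclideanSpace.norm_eq]
  simp only [sum_consistent_fingerprint_apply, ← hC]
  have h1 : ∑ x, ‖((C * revealedSign s κ x : ℝ) : ℂ)‖ ^ 2 = C ^ 2 * ((d - d / S : ℕ) : ℝ) := by
    rw [← sum_revealedSign_sq s κ, Finset.mul_sum]
    refine Finset.sum_congr rfl fun x _ => ?_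
    rw [Complex.norm_real, Real.norm_eq_abs, sq_abs, mul_pow]
  rw [h1, Real.sqrt_mul (sq_nonneg C), Real.sqrt_sq hC0.le, smul_eq_mul, ← Complex.ofReal_mul]
  congr 1
  field_simp

/-- The probability that a fingerprinting state passes the test for the substring `κ`. -/
noncomputable def passProb (s : Fin S) (κ : Fin (d - d / S) → Bool) (x : Fin d → Bool) : ℝ :=
  (∑ a, revealedSign s κ a * boolSign (x a)) ^ 2 / (d * ((d - d / S : ℕ) : ℝ))

theorem passProb_nonneg (s : Fin S) (κ : Fin (d - d / S) → Bool) (x : Fin d → Bool) :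
    0 ≤ passProb s κ x := by
  unfold passProb; positivity

theorem sum_revealedSign_mul (s : Fin S) (κ : Fin (d - d / S) → Bool) (x : Fin d → Bool) :
    ∑ a, revealedSign s κ a * boolSign (x a)
      = ∑ j, boolSign (κ j) * boolSign (revealedSubstring x s j) := by
  rw [sum_eq_sum_revealedPos s _ fun a ha => by rw [revealedSign_of_mem κ ha, zero_mul]]
  simp only [revealedSign_revealedPos, revealedSubstring]

/-- The statistic is a sum of `d - d / S` signs. Hence no substring, forged or honest, passes with
probability above `1 - α`. -/
theorem passProb_le (hd : 0 < d) (s : Fin S) (κ : Fin (d - d / S) → Bool) (x : Fin d → Bool) :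
    passProb s κ x ≤ ((d - d / S : ℕ) : ℝ) / d := by
  have hd' : (0 : ℝ) < d := by exact_mod_cast hd
  have h1 : |∑ a, revealedSign s κ a * boolSign (x a)| ≤ ((d - d / S : ℕ) : ℝ) := by
    rw [sum_revealedSign_mul]
    refine (Finset.abs_sum_le_sum_abs _ _).trans ?_
    simp [abs_mul, abs_boolSign]
  have h2 : (∑ a, revealedSign s κ a * boolSign (x a)) ^ 2 ≤ ((d - d / S : ℕ) : ℝ) ^ 2 := by
    rw [← sq_abs]; exact pow_le_pow_left₀ (abs_nonneg _) h1 2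
  rw [passProb]
  rcases (Nat.cast_nonneg (α := ℝ) (d - d / S)).eq_or_lt with h0 | h0
  · rw [← h0]; simp
  · rw [div_le_div_iff₀ (by positivity) hd']
    nlinarith

theorem passProb_honest (s : Fin S) (x : Fin d → Bool) :
    passProb s (revealedSubstring x s) x = ((d - d / S : ℕ) : ℝ) / d := by
  rw [passProb, sum_revealedSign_mul]
  simp only [boolSign_mul_self]
  rw [Finset.sum_const, Finset.card_univ, Fintype.card_fin, nsmul_eq_mul, mul_one]
  rcases (Nat.cast_nonneg (α := ℝ) (d - d / S)).eq_or_lt with h0 | h0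
  · rw [← h0]; simp
  · rw [sq, mul_div_mul_right _ _ h0.ne']

theorem passProb_le_one (hd : 0 < d) (s : Fin S) (κ : Fin (d - d / S) → Bool)
    (x : Fin d → Bool) : passProb s κ x ≤ 1 := by
  refine (passProb_le hd s κ x).trans ?_
  rw [div_le_one (by exact_mod_cast hd)]
  exact_mod_cast Nat.sub_le _ _

theorem sum_fingerprint_testProjector (hd : 0 < d) (s : Fin S) (κ : Fin (d - d / S) → Bool)
    (x : Fin d → Bool) :
    ∑ a, ∑ a', star (fingerprint x a) * testProjector s κ a a' * fingerprint x a'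
      = (passProb s κ x : ℂ) := by
  simp only [testProjector, Matrix.of_apply, testVector_apply hd, fingerprint_apply,
    RCLike.star_def, Complex.conj_ofReal]
  norm_cast
  have hd' : (0 : ℝ) ≤ d := Nat.cast_nonneg d
  have hl' : (0 : ℝ) ≤ ((d - d / S : ℕ) : ℝ) := Nat.cast_nonneg _
  set A := ∑ a, revealedSign s κ a * boolSign (x a) with hA
  have h1 : ∀ a a', (Real.sqrt d)⁻¹ * boolSign (x a)
      * ((Real.sqrt ((d - d / S : ℕ) : ℝ))⁻¹ * revealedSign s κ a
        * ((Real.sqrt ((d - d / S : ℕ) : ℝ))⁻¹ * revealedSign s κ a'))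
      * ((Real.sqrt d)⁻¹ * boolSign (x a'))
      = (d * ((d - d / S : ℕ) : ℝ))⁻¹ * ((revealedSign s κ a * boolSign (x a))
        * (revealedSign s κ a' * boolSign (x a'))) := by
    intro a a'
    have e1 : (Real.sqrt d)⁻¹ * (Real.sqrt d)⁻¹ = (d : ℝ)⁻¹ := by
      rw [← mul_inv, Real.mul_self_sqrt hd']
    have e2 : (Real.sqrt ((d - d / S : ℕ) : ℝ))⁻¹ * (Real.sqrt ((d - d / S : ℕ) : ℝ))⁻¹
        = (((d - d / S : ℕ) : ℝ))⁻¹ := by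
      rw [← mul_inv, Real.mul_self_sqrt hl']
    rw [mul_inv, ← e1, ← e2]
    ring
  simp only [h1, ← Finset.mul_sum, ← Finset.sum_mul]
  rw [passProb, ← hA]
  ring

theorem sum_fingerprint_one (hd : 0 < d) (x : Fin d → Bool) :
    ∑ a, ∑ a', star (fingerprint x a) * (1 : Matrix (Fin d) (Fin d) ℂ) a a' * fingerprint x a'
      = 1 := by
  have hd' : (0 : ℝ) < d := by exact_mod_cast hd
  simp only [fingerprint_apply, RCLike.star_def, Complex.conj_ofReal, Matrix.one_apply, mul_ite,
    mul_one, mul_zero, ite_mul, zero_mul, Finset.sum_ite_eq, Finset.mem_univ, if_true]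
  norm_cast
  have h : ∀ a, (Real.sqrt d)⁻¹ * boolSign (x a) * ((Real.sqrt d)⁻¹ * boolSign (x a))
      = (d : ℝ)⁻¹ := by
    intro a
    rw [mul_mul_mul_comm, boolSign_mul_self, ← mul_inv, Real.mul_self_sqrt hd'.le, mul_one]
  simp [h, hd'.ne']

end TestVectors

/-! ### Independent failures and the exponential Markov inequality -/

section Patterns

/-- The probability of the pattern `b` of independent failures, where the `i`-th test is passed
with probability `w i`. -/
noncomputable def patternWeight {N : ℕ} (w : Fin N → ℝ) (b : Fin N → Bool) : ℝ :=
  ∏ i, if b i then 1 - w i else w i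

theorem patternWeight_nonneg {N : ℕ} {w : Fin N → ℝ} (h0 : ∀ i, 0 ≤ w i) (h1 : ∀ i, w i ≤ 1)
    (b : Fin N → Bool) : 0 ≤ patternWeight w b :=
  Finset.prod_nonneg fun i _ => by split_ifs <;> linarith [h0 i, h1 i]

theorem sum_patternWeight_mul_prod {N : ℕ} (w : Fin N → ℝ) (y : ℝ) :
    ∑ b : Fin N → Bool, patternWeight w b * ∏ i, (if b i then y else 1)
      = ∏ i, (w i + y * (1 - w i)) := by
  simp only [patternWeight, ← Finset.prod_mul_distrib]
  rw [← Fintype.prod_sum fun i (b : Bool) =>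
    (if b then 1 - w i else w i) * (if b then y else 1)]
  refine Finset.prod_congr rfl fun i _ => ?_
  simp
  ring

theorem sum_patternWeight {N : ℕ} (w : Fin N → ℝ) :
    ∑ b : Fin N → Bool, patternWeight w b = 1 := by
  have := sum_patternWeight_mul_prod w 1
  simpa using this

/-- Exponential Markov inequality for the number of failures. -/
theorem sum_filter_patternWeight_le {N : ℕ} {w : Fin N → ℝ} (h0 : ∀ i, 0 ≤ w i)
    (h1 : ∀ i, w i ≤ 1) (t z : ℝ) (p : (Fin N → Bool) → Prop) [DecidablePred p]
    (hp : ∀ b, p b → 0 ≤ t * ((Finset.univ.filter (fun i => b i = true)).card - z)) :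
    ∑ b ∈ Finset.univ.filter p, patternWeight w b
      ≤ Real.exp (-(t * z)) * ∏ i, (w i + Real.exp t * (1 - w i)) := by
  rw [← sum_patternWeight_mul_prod, Finset.mul_sum]
  have key : ∀ b : Fin N → Bool, Real.exp (-(t * z))
      * (patternWeight w b * ∏ i, (if b i then Real.exp t else 1))
      = patternWeight w b
        * Real.exp (t * ((Finset.univ.filter (fun i => b i = true)).card - z)) := by
    intro b
    rw [← Finset.prod_filter, Finset.prod_const, ← Real.exp_nat_mul, mul_left_comm,
      ← Real.exp_add]
    ring_nf
  calc ∑ b ∈ Finset.univ.filter p, patternWeight w b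
      ≤ ∑ b ∈ Finset.univ.filter p, Real.exp (-(t * z))
          * (patternWeight w b * ∏ i, (if b i then Real.exp t else 1)) := by
        refine Finset.sum_le_sum fun b hb => ?_
        rw [key]
        exact le_mul_of_one_le_right (patternWeight_nonneg h0 h1 b)
          (Real.one_le_exp (hp b (Finset.mem_filter.mp hb).2))
    _ ≤ _ := by
        refine Finset.sum_le_sum_of_subset_of_nonneg (Finset.filter_subset _ _) fun b _ _ => ?_
        rw [key]
        exact mul_nonneg (patternWeight_nonneg h0 h1 b) (Real.exp_pos _).le

/-- State and projector are both products, so the Born sum over multi-indices factors. For a fixed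
key the failures are independent. -/
theorem patternProb_pub {K N d S : ℕ} (hd : 0 < d) (enc : (Fin K → Fin S) → (Fin N → Fin S))
    (zacc zrej : ℝ) (k : Fin N → Fin d → Bool) (c : Fin N → Fin S)
    (κ : Fin N → Fin (d - d / S) → Bool) (b : Fin N → Bool) :
    patternProb c κ ((fingerprintScheme d S enc zacc zrej).pub k) b
      = patternWeight (fun i => passProb (c i) (κ i) (k i)) b := by
  have h1 : ∀ i, ∑ a, ∑ a', star (fingerprint (k i) a)
      * (if b i then 1 - testProjector (c i) (κ i) else testProjector (c i) (κ i)) a a'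
      * fingerprint (k i) a'
      = (((if b i then 1 - passProb (c i) (κ i) (k i) else passProb (c i) (κ i) (k i)) : ℝ) :
        ℂ) := by
    intro i
    split_ifs
    · simp only [Matrix.sub_apply, mul_sub, sub_mul, Finset.sum_sub_distrib]
      rw [sum_fingerprint_one hd, sum_fingerprint_testProjector hd]
      push_cast
      rfl
    · exact sum_fingerprint_testProjector hd _ _ _
  rw [patternProb, patternWeight, ← Complex.ofReal_re (∏ i, _), Complex.ofReal_prod]
  simp only [← h1]
  rw [Fintype.prod_sum]
  refine congrArg Complex.re ?_
  refine Finset.sum_congr rfl fun a _ => ?_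
  rw [Fintype.prod_sum]
  refine Finset.sum_congr rfl fun a' _ => ?_
  change star (∏ i, fingerprint (k i) (a i))
    * (∏ i, (if b i then 1 - testProjector (c i) (κ i) else testProjector (c i) (κ i)) (a i) (a' i))
    * ∏ i, fingerprint (k i) (a' i) = _
  rw [star_prod, Finset.prod_mul_distrib, Finset.prod_mul_distrib]

theorem verif_pub {K N d S : ℕ} (hd : 0 < d) (enc : (Fin K → Fin S) → (Fin N → Fin S))
    (zacc zrej : ℝ) (k : Fin N → Fin d → Bool) (x : Fin K → Fin S)
    (r : Fin N → Fin (d - d / S) → Bool) (v : Verdict) :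
    (fingerprintScheme d S enc zacc zrej).verif ((fingerprintScheme d S enc zacc zrej).pub k) x r v
      = ∑ b ∈ Finset.univ.filter (fun b : Fin N → Bool =>
          verdictOf zacc zrej (Finset.univ.filter (fun i => b i = true)).card = v),
        patternWeight (fun i => passProb (enc x i) (r i) (k i)) b :=
  Finset.sum_congr rfl fun b _ => patternProb_pub hd enc zacc zrej k (enc x) r b

end Patterns

/-! ### From conditional means to the mean of a product -/

section ProductBound

variable {I X : Type*} [Fintype I] [DecidableEq I] [Fintype X]

theorem sum_sum_update (i : I) (F : (I → X) → ℝ) :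
    ∑ h, ∑ x, F (Function.update h i x) = Fintype.card X * ∑ h, F h := by
  rw [← (Equiv.funSplitAt i X).symm.sum_comp, ← (Equiv.funSplitAt i X).symm.sum_comp F,
    Fintype.sum_prod_type, Fintype.sum_prod_type]
  have : ∀ (y : X) (z : {j // j ≠ i} → X) (x : X),
      Function.update ((Equiv.funSplitAt i X).symm (y, z)) i x
        = (Equiv.funSplitAt i X).symm (x, z) := by
    intro y z x
    funext j
    by_cases hj : j = i
    · subst hj; simp
    · simp [hj]
  simp only [this]
  rw [Finset.sum_const, Finset.card_univ, nsmul_eq_mul, Finset.sum_comm]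

/-- A bound on conditional means, one coordinate at a time, gives a bound on the mean of the
product. -/
theorem sum_mul_prod_le [Nonempty X] {G : (I → X) → ℝ} {f : I → X → ℝ} {β : I → ℝ}
    (hf : ∀ i x, 0 ≤ f i x) (hβ : ∀ i, 0 ≤ β i)
    (h : ∀ i k, ∑ x, G (Function.update k i x) * f i x
      ≤ β i * ∑ x, G (Function.update k i x)) :
    ∑ k, G k * ∏ i, f i (k i) ≤ (∏ i, β i) * ∑ k, G k := by
  have hcard : (0 : ℝ) < Fintype.card X := by exact_mod_cast Fintype.card_pos
  suffices H : ∀ s : Finset I, ∑ k, G k * ∏ i ∈ s, f i (k i) ≤ (∏ i ∈ s, β i) * ∑ k, G k from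
    H Finset.univ
  intro s
  induction s using Finset.induction_on with
  | empty => simp
  | insert i s his ih =>
    have hs : ∀ (k : I → X) x, ∏ j ∈ s, f j (Function.update k i x j) = ∏ j ∈ s, f j (k j) := by
      intro k x
      refine Finset.prod_congr rfl fun j hj => ?_
      rw [Function.update_of_ne]
      rintro rfl
      exact his hj
    have step : ∑ k, G k * ∏ j ∈ insert i s, f j (k j)
        ≤ β i * ∑ k, G k * ∏ j ∈ s, f j (k j) := by
      -- The factor `Fintype.card X` pays for resampling coordinate `i`; the product over `s` does
      -- not see it and comes out of the inner sum.
      refine le_of_mul_le_mul_left ?_ hcard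
      rw [mul_left_comm, ← sum_sum_update i, ← sum_sum_update i, Finset.mul_sum]
      refine Finset.sum_le_sum fun k _ => ?_
      simp only [Finset.prod_insert his, hs, Function.update_self]
      have e1 : ∀ x, G (Function.update k i x) * (f i x * ∏ j ∈ s, f j (k j))
          = G (Function.update k i x) * f i x * ∏ j ∈ s, f j (k j) := fun x => by ring
      simp only [e1, ← Finset.sum_mul]
      rw [← mul_assoc]
      exact mul_le_mul_of_nonneg_right (h i k) (Finset.prod_nonneg fun j _ => hf j _)
    rw [Finset.prod_insert his]
    calc _ ≤ β i * ∑ k, G k * ∏ j ∈ s, f j (k j) := step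
      _ ≤ β i * ((∏ j ∈ s, β j) * ∑ k, G k) := mul_le_mul_of_nonneg_left ih (hβ i)
      _ = _ := by ring

end ProductBound

/-! ### Splitting a key string into hidden and revealed bits -/

section HiddenBlock

variable {d S : ℕ}

/-- An enumeration of the hidden positions. -/
noncomputable def hiddenEquiv (s : Fin S) : {a // a ∈ hiddenSet d S s} ≃ Fin (d / S) :=
  Finset.equivFinOfCardEq (card_hiddenSet s)

/-- The string with hidden bits `h` and revealed bits `z`. -/
noncomputable def joinHidden (s : Fin S) (h : Fin (d / S) → Bool)
    (z : {a // a ∉ hiddenSet d S s} → Bool) (a : Fin d) : Bool :=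
  if ha : a ∈ hiddenSet d S s then h (hiddenEquiv s ⟨a, ha⟩) else z ⟨a, ha⟩

theorem sum_eq_sum_joinHidden (s : Fin S) (F : (Fin d → Bool) → ℝ) :
    ∑ x, F x = ∑ z : {a // a ∉ hiddenSet d S s} → Bool, ∑ h, F (joinHidden s h z) := by
  rw [← (Equiv.piEquivPiSubtypeProd (fun a => a ∈ hiddenSet d S s) fun _ => Bool).symm.sum_comp,
    Fintype.sum_prod_type, Finset.sum_comm]
  refine Finset.sum_congr rfl fun z _ => ?_
  rw [← (Equiv.arrowCongr (hiddenEquiv s) (Equiv.refl Bool)).symm.sum_comp]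
  rfl

theorem joinHidden_of_mem (s : Fin S) (h : Fin (d / S) → Bool)
    (z : {a // a ∉ hiddenSet d S s} → Bool) {a : Fin d} (ha : a ∈ hiddenSet d S s) :
    joinHidden s h z a = h (hiddenEquiv s ⟨a, ha⟩) := dif_pos ha

theorem joinHidden_of_notMem (s : Fin S) (h : Fin (d / S) → Bool)
    (z : {a // a ∉ hiddenSet d S s} → Bool) {a : Fin d} (ha : a ∉ hiddenSet d S s) :
    joinHidden s h z a = z ⟨a, ha⟩ := dif_neg ha

theorem revealedSubstring_joinHidden (s : Fin S) (h : Fin (d / S) → Bool)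
    (z : {a // a ∉ hiddenSet d S s} → Bool) :
    revealedSubstring (joinHidden s h z) s
      = fun j => z ⟨revealedPos d S s j, revealedPos_notMem s j⟩ :=
  funext fun j => joinHidden_of_notMem s h z (revealedPos_notMem s j)

theorem abs_revealedSign (s : Fin S) (κ : Fin (d - d / S) → Bool) (a : Fin d) :
    |revealedSign s κ a| = if a ∈ hiddenSet d S s then 0 else 1 := by
  split_ifs with ha
  · rw [revealedSign_of_mem κ ha, abs_zero]
  · obtain ⟨j, rfl⟩ := exists_revealedPos_of_notMem ha
    rw [revealedSign_revealedPos, abs_boolSign]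

theorem sum_hidden_add_sum_revealed (s : Fin S) (f : Fin d → ℝ) :
    ∑ a : {a // a ∈ hiddenSet d S s}, f a + ∑ a : {a // a ∉ hiddenSet d S s}, f a = ∑ a, f a := by
  rw [← Fintype.sum_subtype_add_sum_subtype (fun a => a ∈ hiddenSet d S s) f]
  congr!

/-- If the symbols differ, the test statistic is an affine form in the bits that are hidden for
the signed symbol. -/
theorem exists_passProb_joinHidden {s s' : Fin S} (hs : s ≠ s') (κ : Fin (d - d / S) → Bool)
    (z : {a // a ∉ hiddenSet d S s} → Bool) :
    ∃ (τ : Fin (d / S) → ℝ) (R : ℝ), (∀ j, |τ j| ≤ 1) ∧ |R| ≤ (d : ℝ) - 2 * (d / S : ℕ) ∧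
      ∀ h, passProb s' κ (joinHidden s h z)
        = (R + cubeLinear τ h) ^ 2 / (d * ((d : ℝ) - (d / S : ℕ))) := by
  refine ⟨fun j => revealedSign s' κ ((hiddenEquiv s).symm j),
    ∑ a : {a // a ∉ hiddenSet d S s}, revealedSign s' κ a * boolSign (z a),
    fun j => abs_revealedSign_le _ _ _, ?_, fun h => ?_⟩
  -- `R` collects the positions revealed for both symbols. There are `d - 2 (d / S)` of them because
  -- the hidden blocks are disjoint.
  · refine (Finset.abs_sum_le_sum_abs _ _).trans ?_
    simp only [abs_mul, abs_boolSign, mul_one, abs_revealedSign]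
    have h1 := sum_hidden_add_sum_revealed s
      (fun a => if a ∈ hiddenSet d S s' then (0 : ℝ) else 1)
    have h2 : ∑ a : {a // a ∈ hiddenSet d S s},
        (if (a : Fin d) ∈ hiddenSet d S s' then (0 : ℝ) else 1) = (d / S : ℕ) := by
      rw [Finset.sum_congr rfl fun a _ =>
        if_neg (Finset.disjoint_left.mp (disjoint_hiddenSet hs) a.2)]
      simp [card_hiddenSet]
    have h3 : ∑ a : Fin d, (if a ∈ hiddenSet d S s' then (0 : ℝ) else 1)
        = (d : ℝ) - (d / S : ℕ) := by
      have : ∀ a : Fin d, (if a ∈ hiddenSet d S s' then (0 : ℝ) else 1)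
          = 1 - if a ∈ hiddenSet d S s' then 1 else 0 := by
        intro a; split_ifs <;> norm_num
      simp only [this, Finset.sum_sub_distrib]
      simp [card_hiddenSet]
    rw [h2, h3] at h1
    linarith
  · have h1 := sum_hidden_add_sum_revealed s
      (fun a => revealedSign s' κ a * boolSign (joinHidden s h z a))
    have h2 : ∑ a : {a // a ∈ hiddenSet d S s},
        revealedSign s' κ a * boolSign (joinHidden s h z a)
        = cubeLinear (fun j => revealedSign s' κ ((hiddenEquiv s).symm j)) h := by
      rw [cubeLinear, ← (hiddenEquiv s).sum_comp]
      refine Finset.sum_congr rfl fun a _ => ?_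
      rw [joinHidden_of_mem s h z a.2, Equiv.symm_apply_apply]
    have h3 : ∑ a : {a // a ∉ hiddenSet d S s},
        revealedSign s' κ a * boolSign (joinHidden s h z a)
        = ∑ a : {a // a ∉ hiddenSet d S s}, revealedSign s' κ a * boolSign (z a) :=
      Finset.sum_congr rfl fun a _ => by rw [joinHidden_of_notMem s h z a.2]
    rw [h2, h3] at h1
    rw [passProb, ← h1, add_comm, Nat.cast_sub (Nat.div_le_self d S)]

end HiddenBlock

/-! ### The public key as a low-degree polynomial -/

section PublicKey

variable {V : Type*} [NormedAddCommGroup V] [InnerProductSpace ℂ V] {d S : ℕ}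

/-- Each amplitude is a constant times the sign of one bit. It raises the degree by one if the bit
is hidden and not at all otherwise. -/
theorem degLE_prod_fingerprint (s : Fin S) (z : {a // a ∉ hiddenSet d S s} → Bool) (T : ℕ)
    (b : Fin T → Fin d) (v : V) :
    DegLE (d / S) T fun h => (∏ t, fingerprint (joinHidden s h z) (b t)) • v := by
  induction T with
  | zero => simpa using DegLE.const (d / S) 0 v
  | succ T ih =>
    have h1 := ih fun t => b t.succ
    simp only [Fin.prod_univ_succ, mul_smul, fingerprint_apply (a := b 0)]
    by_cases hb : b 0 ∈ hiddenSet d S s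
    · simp only [joinHidden_of_mem s _ z hb, Complex.ofReal_mul, mul_smul]
      exact (h1.sign_smul _).smul _
    · simp only [joinHidden_of_notMem s _ z hb]
      exact (h1.smul _).succ

/-- As a function of the bits that are hidden at one position, any linear image of `T` copies of
the public key is a polynomial of degree at most `T`. -/
theorem degLE_tensorCopies_pub {K N T : ℕ} (enc : (Fin K → Fin S) → (Fin N → Fin S))
    (zacc zrej : ℝ) (L : EuclideanSpace ℂ (Fin T → Fin N → Fin d) →L[ℂ] V)
    (k : Fin N → Fin d → Bool) (i : Fin N) (s : Fin S)
    (z : {a // a ∉ hiddenSet d S s} → Bool) :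
    DegLE (d / S) T fun h => L (tensorCopies T
      ((fingerprintScheme d S enc zacc zrej).pub (Function.update k i (joinHidden s h z)))) := by
  have e : ∀ ψ : EuclideanSpace ℂ (Fin T → Fin N → Fin d),
      L ψ = ∑ a, ψ a • L (EuclideanSpace.basisFun _ ℂ a) := by
    intro ψ
    conv_lhs => rw [← (EuclideanSpace.basisFun (Fin T → Fin N → Fin d) ℂ).sum_repr ψ]
    rw [map_sum]
    exact Finset.sum_congr rfl fun a _ => by rw [map_smul, EuclideanSpace.basisFun_repr]
  rw [funext fun h => e (tensorCopies T
    ((fingerprintScheme d S enc zacc zrej).pub (Function.update k i (joinHidden s h z))))]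
  refine DegLE.sum _ fun a _ => ?_
  -- Only the `i`-th qudit of each copy depends on the hidden bits, which leaves `T` varying
  -- amplitudes.
  have h1 : ∀ h, tensorCopies T ((fingerprintScheme d S enc zacc zrej).pub
      (Function.update k i (joinHidden s h z))) a
      = (∏ t, ∏ j ∈ Finset.univ.erase i, fingerprint (k j) (a t j))
        * ∏ t, fingerprint (joinHidden s h z) (a t i) := by
    intro h
    rw [← Finset.prod_mul_distrib]
    change ∏ t, ∏ j, fingerprint (Function.update k i (joinHidden s h z) j) (a t j) = _
    refine Finset.prod_congr rfl fun t _ => ?_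
    rw [← Finset.mul_prod_erase _ _ (Finset.mem_univ i), Function.update_self, mul_comm]
    congr 1
    refine Finset.prod_congr rfl fun j hj => ?_
    rw [Function.update_of_ne (Finset.ne_of_mem_erase hj)]
  simp only [h1, mul_smul]
  exact (degLE_prod_fingerprint s z T (fun t => a t i) _).smul _

theorem norm_sq_prod {I J : Type*} [Fintype I] [DecidableEq I] [Fintype J]
    (f : I → EuclideanSpace ℂ J) :
    ‖(WithLp.toLp 2 fun a : I → J => ∏ i, f i (a i) : EuclideanSpace ℂ (I → J))‖ ^ 2
      = ∏ i, ‖f i‖ ^ 2 := by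
  simp only [EuclideanSpace.norm_sq_eq, norm_prod, ← Finset.prod_pow]
  rw [Fintype.prod_sum]

theorem norm_sq_fingerprint (hd : 0 < d) (x : Fin d → Bool) : ‖fingerprint x‖ ^ 2 = 1 := by
  have hd' : (0 : ℝ) < d := by exact_mod_cast hd
  rw [EuclideanSpace.norm_sq_eq]
  have h : ∀ a, ‖fingerprint x a‖ ^ 2 = (d : ℝ)⁻¹ := by
    intro a
    rw [fingerprint_apply, Complex.norm_real, Real.norm_eq_abs, sq_abs, mul_pow, sq (boolSign _),
      boolSign_mul_self, inv_pow, Real.sq_sqrt hd'.le, mul_one]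
  simp [h, hd'.ne']

theorem norm_sq_tensorCopies_pub {K N : ℕ} (hd : 0 < d)
    (enc : (Fin K → Fin S) → (Fin N → Fin S)) (zacc zrej : ℝ) (T : ℕ)
    (k : Fin N → Fin d → Bool) :
    ‖tensorCopies T ((fingerprintScheme d S enc zacc zrej).pub k)‖ ^ 2 = 1 := by
  have h1 : ‖(fingerprintScheme d S enc zacc zrej).pub k‖ ^ 2 = 1 :=
    (norm_sq_prod fun i => fingerprint (k i)).trans (by simp [norm_sq_fingerprint hd])
  exact (norm_sq_prod fun _ : Fin T => (fingerprintScheme d S enc zacc zrej).pub k).trans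
    (by simp [h1])

end PublicKey

/-! ### The forger at one position -/

section Forger

variable {V : Type} [NormedAddCommGroup V] [InnerProductSpace ℂ V] [CompleteSpace V]

/-- Factoring `E = B* B` makes an outcome probability the squared norm of a linear image, the form
required by the moment bound. -/
theorem exists_re_inner_eq_norm_sq {E : V →L[ℂ] V} (hE : E.IsPositive) :
    ∃ B : V →L[ℂ] V, ∀ x, (inner ℂ x (E x)).re = ‖B x‖ ^ 2 := by
  obtain ⟨B, hB⟩ := CStarAlgebra.nonneg_iff_eq_star_mul_self.mp
    ((ContinuousLinearMap.nonneg_iff_isPositive E).mpr hE)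
  refine ⟨B, fun x => ?_⟩
  rw [hB, mul_apply_eq_comp, ContinuousLinearMap.star_eq_adjoint,
    ContinuousLinearMap.adjoint_inner_right]
  exact inner_self_eq_norm_sq (𝕜 := ℂ) (B x)

theorem ForgeryAdversary.outputProb_nonneg {ι Key Msg Sig : Type} [Fintype ι] [Fintype Msg]
    [Fintype Sig] {T : ℕ} (A : ForgeryAdversary ι Msg Sig T V)
    (Q : SignatureScheme ι Key Msg Sig) (k : Key) (m : Msg) (o : Msg × Sig) :
    0 ≤ A.outputProb Q k m o :=
  (A.povm_pos m (Q.sign k m) o).re_inner_nonneg_right _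

theorem ForgeryAdversary.sum_outputProb {ι Key Msg Sig : Type} [Fintype ι] [Fintype Msg]
    [Fintype Sig] {T : ℕ} (A : ForgeryAdversary ι Msg Sig T V)
    (Q : SignatureScheme ι Key Msg Sig) (k : Key) :
    ∑ m, ∑ o, A.outputProb Q k m o = ‖tensorCopies T (Q.pub k)‖ ^ 2 := by
  rw [← A.meas_complete]
  refine Finset.sum_congr rfl fun m _ => ?_
  simp only [ForgeryAdversary.outputProb]
  rw [← Complex.re_sum, ← inner_sum, ← sum_apply, A.povm_sum,
    one_apply_eq_self]
  exact inner_self_eq_norm_sq (𝕜 := ℂ) _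

variable {K N d S T : ℕ} {α : ℝ} (enc : (Fin K → Fin S) → (Fin N → Fin S)) (zacc zrej : ℝ)

/-- Conditionally on the outputs of the forger and on all key symbols but one, the pass probability
at a position where the codewords differ is at most `p₁` in the mean. -/
theorem ForgeryAdversary.sum_outputProb_mul_passProb_le (hS : 2 ≤ S) (hd : 0 < d) (hSd : S ∣ d)
    (hα : α = 1 / (S : ℝ)) (hφ : phiParam d T ≤ α)
    (A : ForgeryAdversary (Fin N → Fin d) (Fin K → Fin S) (Fin N → Fin (d - d / S) → Bool) T V)
    (m : Fin K → Fin S) (o : (Fin K → Fin S) × (Fin N → Fin (d - d / S) → Bool)) (i : Fin N)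
    (hi : enc m i ≠ enc o.1 i) (k : Fin N → Fin d → Bool) :
    ∑ x, A.outputProb (fingerprintScheme d S enc zacc zrej) (Function.update k i x) m o
        * passProb (enc o.1 i) (o.2 i) x
      ≤ p1Param α d T
        * ∑ x, A.outputProb (fingerprintScheme d S enc zacc zrej) (Function.update k i x) m o := by
  have hSpos : 0 < S := by omega
  have hn0 : 0 < d / S := Nat.div_pos (Nat.le_of_dvd hd hSd) hSpos
  have hnS : d / S * S = d := Nat.div_mul_cancel hSd
  have hn : ((d / S : ℕ) : ℝ) = α * d := by
    have : (S : ℝ) ≠ 0 := by positivity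
    rw [hα, Nat.cast_div hSd this]
    field_simp
  have h2n : 2 * (d / S) ≤ d := by nlinarith
  rw [sum_eq_sum_joinHidden (enc m i), sum_eq_sum_joinHidden (enc m i), Finset.mul_sum]
  refine Finset.sum_le_sum fun z _ => ?_
  -- For fixed `z` the signature of `m` does not depend on the hidden bits, so a single POVM element
  -- is involved.
  set r : Fin N → Fin (d - d / S) → Bool := Function.update
    (fun j => revealedSubstring (k j) (enc m j)) i
    (fun j => z ⟨revealedPos d S (enc m i) j, revealedPos_notMem _ j⟩) with hr
  have hsign : ∀ h, (fingerprintScheme d S enc zacc zrej).sign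
      (Function.update k i (joinHidden (enc m i) h z)) m = r := by
    intro h
    funext j
    change revealedSubstring (Function.update k i (joinHidden (enc m i) h z) j) (enc m j) = r j
    by_cases hj : j = i
    · subst hj
      rw [Function.update_self, hr, Function.update_self, revealedSubstring_joinHidden]
    · rw [Function.update_of_ne hj, hr, Function.update_of_ne hj]
  obtain ⟨B, hB⟩ := exists_re_inner_eq_norm_sq (A.povm_pos m r o)
  have hout : ∀ h, A.outputProb (fingerprintScheme d S enc zacc zrej)
      (Function.update k i (joinHidden (enc m i) h z)) m o
      = ‖(B.comp (A.meas m)) (tensorCopies T ((fingerprintScheme d S enc zacc zrej).pub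
          (Function.update k i (joinHidden (enc m i) h z))))‖ ^ 2 := by
    intro h
    rw [ForgeryAdversary.outputProb, hsign, hB]
    rfl
  obtain ⟨τ, R, hτ, hR, hpass⟩ := exists_passProb_joinHidden hi (o.2 i) z
  simp only [hout, hpass]
  exact (degLE_tensorCopies_pub enc zacc zrej (B.comp (A.meas m)) k i (enc m i)
    z).sum_normSq_mul_pass_le hn hn0 (Nat.div_dvd_of_dvd hSd) h2n hφ hτ hR

end Forger

/-! ### Chernoff bounds -/

section Tails

theorem one_add_mul_log_one_add_ge {δ : ℝ} (h0 : 0 ≤ δ) (h1 : δ ≤ 1) :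
    δ + δ ^ 2 / 3 ≤ (1 + δ) * Real.log (1 + δ) := by
  have h2 := Real.le_log_one_add_of_nonneg h0
  have h3 : δ + δ ^ 2 / 3 ≤ (1 + δ) * (2 * δ / (δ + 2)) := by
    rw [mul_div_assoc', le_div_iff₀ (by linarith)]
    nlinarith [mul_nonneg (sq_nonneg δ) (sub_nonneg.mpr h1)]
  exact h3.trans (mul_le_mul_of_nonneg_left h2 (by linarith))

/-- This is `t ≤ sinh t` at `t = -log (1 - δ)`, multiplied by `1 - δ`. -/
theorem one_sub_mul_log_one_sub_ge {δ : ℝ} (h0 : 0 ≤ δ) (h1 : δ < 1) :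
    -δ + δ ^ 2 / 2 ≤ (1 - δ) * Real.log (1 - δ) := by
  have hu : 0 < 1 - δ := by linarith
  have hl : 0 ≤ Real.log (1 - δ)⁻¹ := Real.log_nonneg ((one_le_inv₀ hu).mpr (by linarith))
  have h := Real.self_le_sinh_iff.mpr hl
  rw [Real.sinh_log (inv_pos.mpr hu), Real.log_inv, inv_inv] at h
  have h2 := mul_le_mul_of_nonneg_left h hu.le
  have h3 : (1 - δ) * (((1 - δ)⁻¹ - (1 - δ)) / 2) = δ - δ ^ 2 / 2 := by
    field_simp
    ring
  rw [h3] at h2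
  linarith

/-- Chernoff bound for the number of failures of `N` independent tests with failure probability
`α`. -/
theorem sum_patternWeight_acc1_ge {N : ℕ} {α a zacc zrej : ℝ} (hα0 : 0 < α) (hα1 : α ≤ 1)
    (hN : 0 < (N : ℝ)) (ha : 0 ≤ a) (haN : a ≤ Real.sqrt (N * α))
    (hz : zacc = N * α + Real.sqrt (N * α) * a) :
    1 - Real.exp (-(a ^ 2 / 3)) ≤ ∑ b ∈ Finset.univ.filter (fun b : Fin N → Bool =>
        verdictOf zacc zrej (Finset.univ.filter (fun i => b i = true)).card = Verdict.acc1),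
      patternWeight (fun _ => 1 - α) b := by
  have hm : 0 < N * α := mul_pos hN hα0
  set x := Real.sqrt (N * α) with hx
  have hx0 : 0 < x := Real.sqrt_pos.mpr hm
  have hxx : x ^ 2 = N * α := Real.sq_sqrt hm.le
  -- Then `zacc = (1 + δ) N α` and `N α δ ^ 2 = a ^ 2`; the exponential parameter is `log (1 + δ)`.
  set δ := a / x with hδ
  have hδ0 : 0 ≤ δ := by positivity
  have hδ1 : δ ≤ 1 := by rw [hδ, div_le_one hx0]; exact haN
  have hax : a = δ * x := by rw [hδ]; field_simp
  have hlog := one_add_mul_log_one_add_ge hδ0 hδ1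
  have hlog0 : 0 ≤ Real.log (1 + δ) := Real.log_nonneg (by linarith)
  have hexp : Real.exp (Real.log (1 + δ)) = 1 + δ := Real.exp_log (by linarith)
  have htail := sum_filter_patternWeight_le (N := N) (w := fun _ => 1 - α)
    (fun _ => by linarith) (fun _ => by linarith) (Real.log (1 + δ)) zacc
    (fun b => ¬ verdictOf zacc zrej (Finset.univ.filter (fun i => b i = true)).card
      = Verdict.acc1) (by
      intro b hb
      refine mul_nonneg hlog0 ?_
      by_contra hlt
      refine hb ?_
      rw [verdictOf, if_pos (by linarith)])
  have hsum := sum_patternWeight (N := N) fun _ => 1 - α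
  rw [← Finset.sum_filter_add_sum_filter_not Finset.univ (fun b : Fin N → Bool =>
    verdictOf zacc zrej (Finset.univ.filter (fun i => b i = true)).card = Verdict.acc1)] at hsum
  have hbound : Real.exp (-(Real.log (1 + δ) * zacc))
      * ∏ _i : Fin N, (1 - α + Real.exp (Real.log (1 + δ)) * (1 - (1 - α)))
      ≤ Real.exp (-(a ^ 2 / 3)) := by
    rw [hexp, Finset.prod_const, Finset.card_univ, Fintype.card_fin]
    have h1 : 1 - α + (1 + δ) * (1 - (1 - α)) ≤ Real.exp (α * δ) := by
      have := Real.add_one_le_exp (α * δ)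
      linarith
    have h2 : (1 - α + (1 + δ) * (1 - (1 - α))) ^ N ≤ Real.exp (N * (α * δ)) := by
      rw [Real.exp_nat_mul]
      exact pow_le_pow_left₀ (by nlinarith) h1 N
    refine (mul_le_mul_of_nonneg_left h2 (Real.exp_pos _).le).trans ?_
    rw [← Real.exp_add, Real.exp_le_exp, hz, hax]
    have h3 : -(Real.log (1 + δ) * (N * α + x * (δ * x))) + N * (α * δ)
        = -((N * α) * ((1 + δ) * Real.log (1 + δ) - δ)) := by
      linear_combination -(Real.log (1 + δ) * δ) * hxx
    rw [h3, mul_pow, hxx]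
    nlinarith [mul_le_mul_of_nonneg_left hlog hm.le]
  linarith

end Tails

/-! ### Consequences of the parameter choice -/

section ParameterBounds

theorem p1Param_nonneg {α : ℝ} (hα1 : α < 1) (d T : ℕ) : 0 ≤ p1Param α d T := by
  have : 0 < 1 - α := by linarith
  unfold p1Param
  positivity

/-- Since `hinv ≤ 1 / 2`, `p₁ ≥ (1 - 2α) ^ 2 / (1 - α) ≥ 1 - 3α`. This bound on the gap is what
allows `√(1 + 4θ)` in the length condition. -/
theorem one_sub_p1Param_sub_le {α : ℝ} (hα0 : 0 < α) (hα2 : α ≤ 1 / 2) {d T : ℕ} (hd : 0 < d)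
    (hφ : phiParam d T ≤ α) : 1 - p1Param α d T - α ≤ 2 * α := by
  have hd1 : (1 : ℝ) ≤ d := by exact_mod_cast hd
  have hφ0 : 0 ≤ phiParam d T := by
    have := Real.logb_nonneg one_lt_two hd1
    unfold phiParam
    positivity
  have hη := binEntropyInv_le (div_nonneg hφ0 hα0.le) ((div_le_one hα0).mpr hφ)
  have hs := Real.sqrt_nonneg (phiParam d T / α)
  set η := binEntropyInv (1 - phiParam d T / α) with hη'
  have h1α : 0 < 1 - α := by linarith
  have hq : 0 ≤ α / (1 - α) := by positivity
  have hq1 : 1 - α / (1 - α) = (1 - 2 * α) / (1 - α) := by field_simp; ring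
  have h1 : (1 - 2 * α) / (1 - α) ≤ 1 - α / (1 - α) * (2 * η) := by
    rw [← hq1]
    nlinarith
  have h2 : ((1 - 2 * α) / (1 - α)) ^ 2 ≤ (1 - α / (1 - α) * (2 * η)) ^ 2 :=
    pow_le_pow_left₀ (div_nonneg (by linarith) h1α.le) h1 2
  have h3 : 0 ≤ Real.sqrt (8 / 3) * (Real.sqrt (α * d) / ((1 - α) * d)) := by positivity
  have h4 : (1 - α) * ((1 - 2 * α) / (1 - α)) ^ 2 ≤ p1Param α d T := by
    rw [p1Param, ← hη']
    exact mul_le_mul_of_nonneg_left (by linarith) h1α.le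
  have h5 : (1 - α) * ((1 - 2 * α) / (1 - α)) ^ 2 = (1 - 2 * α) ^ 2 / (1 - α) := by
    field_simp
  have h6 : 1 - 3 * α ≤ (1 - 2 * α) ^ 2 / (1 - α) := by
    rw [le_div_iff₀ h1α]
    nlinarith
  linarith

/-- The consequences of the choice of the codeword length. -/
theorem thresholds_of_length {α ν g a b N : ℝ} (hα0 : 0 < α) (hν0 : 0 < ν)
    (hg : 0 < g) (hg1 : g ≤ 1) (hgα : g ≤ 2 * α) (ha : 0 < a) (hb : 0 ≤ b)
    (hN : 1 / α ^ 3 * ((a + Real.sqrt (1 + 4 * thetaParam α ν) * b) / (g / α)) ^ 2 ≤ N) :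
    0 < N ∧ a ≤ Real.sqrt (N * α) ∧ 0 < N * α * (1 + (1 + ν) * g) ∧
      N * α + Real.sqrt (N * α) * a < N * α * (1 + (1 + ν) * g)
        - Real.sqrt (N * α * (1 + (1 + ν) * g)) * b := by
  set c := Real.sqrt (1 + 4 * thetaParam α ν) with hc
  have hc0 : 0 ≤ c := Real.sqrt_nonneg _
  have hp : 0 < a + c * b := by positivity
  have hN0 : 0 < N := lt_of_lt_of_le (by positivity) hN
  have hm : 0 < N * α := mul_pos hN0 hα0
  set x := Real.sqrt (N * α) with hx
  have hx0 : 0 < x := Real.sqrt_pos.mpr hm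
  have hxx : x ^ 2 = N * α := Real.sq_sqrt hm.le
  have h1 : (a + c * b) / g ≤ x := by
    apply Real.le_sqrt_of_sq_le
    calc ((a + c * b) / g) ^ 2
        = 1 / α ^ 3 * ((a + c * b) / (g / α)) ^ 2 * α := by field_simp
      _ ≤ N * α := mul_le_mul_of_nonneg_right hN hα0.le
  have h2 : a + c * b ≤ g * x := by
    rw [div_le_iff₀ hg] at h1; linarith
  have hE : 0 < N * α * (1 + (1 + ν) * g) := by positivity
  -- `g ≤ 2α` gives `(1 + ν) g ≤ 4θ`.
  have hsE : Real.sqrt (N * α * (1 + (1 + ν) * g)) ≤ x * c := by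
    rw [hx, hc, ← Real.sqrt_mul hm.le]
    apply Real.sqrt_le_sqrt
    refine mul_le_mul_of_nonneg_left ?_ hm.le
    unfold thetaParam
    nlinarith
  refine ⟨hN0, ?_, hE, ?_⟩
  · have : 0 ≤ c * b := by positivity
    nlinarith
  · have h3 : Real.sqrt (N * α * (1 + (1 + ν) * g)) * b ≤ x * c * b :=
      mul_le_mul_of_nonneg_right hsE hb
    have h4 : x * (a + c * b) ≤ x * (g * x) := mul_le_mul_of_nonneg_left h2 hx0.le
    -- The length condition secures a gap `N α g`, while the means differ by `(1 + ν) N α g`; this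
    -- surplus makes the inequality strict.
    have h5 : 0 < ν * (N * α * g) := by positivity
    nlinarith

end ParameterBounds

/-! ### The tally of a forged signature -/

section Security

variable {V : Type} [NormedAddCommGroup V] [InnerProductSpace ℂ V] [CompleteSpace V]
variable {K N d S T : ℕ} {α : ℝ} (enc : (Fin K → Fin S) → (Fin N → Fin S)) (zacc zrej : ℝ)

/-- A tally above `zrej` also exceeds `zacc` and is rejected. The remaining patterns form a lower
tail, hence `t ≤ 0`. -/
theorem verif_acc0_add_acc1_le (hd : 0 < d) (hz : zacc < zrej) (k : Fin N → Fin d → Bool)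
    (x : Fin K → Fin S) (r : Fin N → Fin (d - d / S) → Bool) {t : ℝ} (ht : t ≤ 0) :
    (fingerprintScheme d S enc zacc zrej).verif ((fingerprintScheme d S enc zacc zrej).pub k) x r
        Verdict.acc0
      + (fingerprintScheme d S enc zacc zrej).verif ((fingerprintScheme d S enc zacc zrej).pub k)
        x r Verdict.acc1
      ≤ Real.exp (-(t * zrej)) * ∏ i, (passProb (enc x i) (r i) (k i)
        + Real.exp t * (1 - passProb (enc x i) (r i) (k i))) := by
  rw [verif_pub hd, verif_pub hd, ← Finset.sum_union, ← Finset.filter_or]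
  · refine sum_filter_patternWeight_le (fun i => passProb_nonneg _ _ _)
      (fun i => passProb_le_one hd _ _ _) t zrej _ ?_
    intro b hb
    refine mul_nonneg_of_nonpos_of_nonpos ht ?_
    simp only [verdictOf] at hb
    by_contra hlt
    rw [if_neg (by linarith), if_pos (by linarith)] at hb
    simp at hb
  · rw [Finset.disjoint_filter]
    intro b _ h1 h2
    rw [h1] at h2
    exact absurd h2 (by decide)

/-- Moment bound for the number of failures, jointly with the outputs of the forger. -/
theorem ForgeryAdversary.sum_outputProb_mul_prod_le (hS : 2 ≤ S) (hd : 0 < d) (hSd : S ∣ d)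
    (hα : α = 1 / (S : ℝ)) (hφ : phiParam d T ≤ α) (hp1 : 0 ≤ p1Param α d T)
    (A : ForgeryAdversary (Fin N → Fin d) (Fin K → Fin S) (Fin N → Fin (d - d / S) → Bool) T V)
    (m : Fin K → Fin S) (o : (Fin K → Fin S) × (Fin N → Fin (d - d / S) → Bool)) {u : ℝ}
    (hu0 : 0 ≤ u) (hu1 : u ≤ 1) :
    ∑ k, A.outputProb (fingerprintScheme d S enc zacc zrej) k m o
        * ∏ i, (passProb (enc o.1 i) (o.2 i) (k i)
          + u * (1 - passProb (enc o.1 i) (o.2 i) (k i)))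
      ≤ (∏ i, (u + (1 - u) * if enc m i ≠ enc o.1 i then p1Param α d T else 1 - α))
        * ∑ k, A.outputProb (fingerprintScheme d S enc zacc zrej) k m o := by
  have hd' : (0 : ℝ) < d := by exact_mod_cast hd
  have hS' : (2 : ℝ) ≤ S := by exact_mod_cast hS
  have hα1 : α ≤ 1 := by rw [hα, div_le_one (by linarith)]; linarith
  have hl : ((d - d / S : ℕ) : ℝ) / d = 1 - α := by
    rw [Nat.cast_sub (Nat.div_le_self d S), Nat.cast_div hSd (by linarith), hα]
    field_simp
  refine sum_mul_prod_le (f := fun i x => passProb (enc o.1 i) (o.2 i) x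
    + u * (1 - passProb (enc o.1 i) (o.2 i) x)) ?_ ?_ ?_
  · intro i x
    have h0 := passProb_nonneg (enc o.1 i) (o.2 i) x
    have h1 := passProb_le_one hd (enc o.1 i) (o.2 i) x
    have := mul_nonneg hu0 (sub_nonneg.mpr h1)
    linarith
  · intro i
    have : 0 ≤ if enc m i ≠ enc o.1 i then p1Param α d T else 1 - α := by
      split_ifs <;> linarith
    have := mul_nonneg (sub_nonneg.mpr hu1) this
    linarith
  · intro i k
    set G : (Fin d → Bool) → ℝ := fun x =>
      A.outputProb (fingerprintScheme d S enc zacc zrej) (Function.update k i x) m o with hG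
    have hmean : ∑ x, G x * passProb (enc o.1 i) (o.2 i) x
        ≤ (if enc m i ≠ enc o.1 i then p1Param α d T else 1 - α) * ∑ x, G x := by
      split_ifs with hi
      · exact A.sum_outputProb_mul_passProb_le enc zacc zrej hS hd hSd hα hφ m o i hi k
      · rw [Finset.mul_sum]
        refine Finset.sum_le_sum fun x _ => ?_
        rw [mul_comm (1 - α)]
        refine mul_le_mul_of_nonneg_left ?_ (A.outputProb_nonneg _ _ _ _)
        rw [← hl]
        exact passProb_le hd _ _ _
    have hsum : ∑ x, G x * (passProb (enc o.1 i) (o.2 i) x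
          + u * (1 - passProb (enc o.1 i) (o.2 i) x))
        = u * ∑ x, G x + (1 - u) * ∑ x, G x * passProb (enc o.1 i) (o.2 i) x := by
      rw [Finset.mul_sum, Finset.mul_sum, ← Finset.sum_add_distrib]
      exact Finset.sum_congr rfl fun x _ => by ring
    rw [hsum]
    nlinarith [mul_le_mul_of_nonneg_left hmean (sub_nonneg.mpr hu1)]

/-- With `δ = b / √E` the threshold is `(1 - δ) E`. Each factor is `1 - δ q ≤ exp (-δ q)` for a
failure bound `q`, and these sum to at least `E`. The exponent is then at most `-E δ ^ 2 / 2 = -b ^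
2 / 2`. -/
theorem exp_mul_prod_le_exp {α g E b u : ℝ} {N : ℕ} (p : Fin N → Prop) [DecidablePred p]
    (hE : 0 < E) (hb : 0 ≤ b) (hu : u = 1 - b / Real.sqrt E) (hu0 : 0 < u)
    (hα1 : α ≤ 1) (hg : α + g ≤ 1) (hEp : E ≤ N * α + (Finset.univ.filter p).card * g) :
    Real.exp (-(Real.log u * (E - Real.sqrt E * b)))
        * ∏ i, (u + (1 - u) * if p i then 1 - α - g else 1 - α) ≤ Real.exp (-(b ^ 2 / 2)) := by
  have hs0 : 0 < Real.sqrt E := Real.sqrt_pos.mpr hE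
  have hss : Real.sqrt E ^ 2 = E := Real.sq_sqrt hE.le
  set δ := b / Real.sqrt E with hδ
  have hδ0 : 0 ≤ δ := by positivity
  have hδ1 : δ < 1 := by linarith
  have hbδ : b = δ * Real.sqrt E := by rw [hδ]; field_simp
  have hlog := one_sub_mul_log_one_sub_ge hδ0 hδ1
  have h1 : ∏ i, (u + (1 - u) * if p i then 1 - α - g else 1 - α)
      ≤ ∏ i : Fin N, Real.exp (-(δ * (α + if p i then g else 0))) := by
    refine Finset.prod_le_prod (fun i _ => ?_) fun i _ => ?_
    · have : 0 ≤ if p i then 1 - α - g else 1 - α := by split_ifs <;> linarith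
      have := mul_nonneg (by linarith : 0 ≤ 1 - u) this
      linarith
    · refine le_trans (le_of_eq ?_) (Real.one_sub_le_exp_neg _)
      split_ifs <;> rw [hu] <;> ring
  have h2 : ∏ i : Fin N, Real.exp (-(δ * (α + if p i then g else 0))) ≤ Real.exp (-(δ * E)) := by
    rw [← Real.exp_sum, Real.exp_le_exp, Finset.sum_neg_distrib, ← Finset.mul_sum,
      Finset.sum_add_distrib, ← Finset.sum_filter]
    simp only [Finset.sum_const, Finset.card_univ, Fintype.card_fin, nsmul_eq_mul]
    exact neg_le_neg (mul_le_mul_of_nonneg_left hEp hδ0)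
  refine (mul_le_mul_of_nonneg_left (h1.trans h2) (Real.exp_pos _).le).trans ?_
  rw [← Real.exp_add, Real.exp_le_exp]
  have h3 : Real.sqrt E * b = E * δ := by rw [hbδ, ← hss, Real.sqrt_sq hs0.le]; ring
  have h4 : b ^ 2 = E * δ ^ 2 := by rw [hbδ, mul_pow, hss]; ring
  rw [h3, h4, hu]
  nlinarith [mul_le_mul_of_nonneg_left hlog hE.le]

end Security

/-! ### Correctness and security of the scheme -/

theorem proposition2
    (K N S d T : ℕ) (α ν εc εf : ℝ)
    (hS : 2 ≤ S) (hd : 0 < d) (hSd : S ∣ d) (hα : α = 1 / (S : ℝ))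
    (hφ : phiParam d T ≤ α)
    (hgap : 0 < 1 - p1Param α d T - α)
    (hν : α < ν)
    (hεc : 0 < εc) (hεc1 : εc < 1) (hεf : 0 < εf) (hεf1 : εf < 1)
    (hN : lengthParam α ν d T εc εf ≤ (N : ℝ))
    (enc : (Fin K → Fin S) → (Fin N → Fin S))
    (henc : ∀ x x' : Fin K → Fin S, x ≠ x' →
      2 * thetaParam α ν * (N : ℝ) ≤ (hammingDist (enc x) (enc x') : ℝ)) :
    α * (N : ℝ) ≤ zAccParam α N εc ∧
    zAccParam α N εc < zRejParam α ν d T N εf ∧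
    (fingerprintScheme d S enc (zAccParam α N εc) (zRejParam α ν d T N εf)).IsCorrect εc ∧
    (fingerprintScheme d S enc (zAccParam α N εc) (zRejParam α ν d T N εf)).IsForgerySecure
      T εf := by
  classical
  have hS' : (2 : ℝ) ≤ S := by exact_mod_cast hS
  have hd' : (0 : ℝ) < d := by exact_mod_cast hd
  have hα0 : 0 < α := by rw [hα]; positivity
  have hα2 : α ≤ 1 / 2 := by
    rw [hα]; exact one_div_le_one_div_of_le two_pos hS'
  have hν0 : 0 < ν := hα0.trans hν
  have hp0 := p1Param_nonneg (α := α) (by linarith) d T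
  have hgα := one_sub_p1Param_sub_le hα0 hα2 hd hφ
  set g := 1 - p1Param α d T - α with hg
  have hlogc : 0 < Real.log εc⁻¹ := Real.log_pos ((one_lt_inv₀ hεc).mpr hεc1)
  have hlogf : 0 < Real.log εf⁻¹ := Real.log_pos ((one_lt_inv₀ hεf).mpr hεf1)
  set a := Real.sqrt (3 * Real.log εc⁻¹) with ha
  set b := Real.sqrt (2 * Real.log εf⁻¹) with hb
  have ha0 : 0 < a := Real.sqrt_pos.mpr (by linarith)
  have hb0 : 0 < b := Real.sqrt_pos.mpr (by linarith)
  have haa : a ^ 2 = 3 * Real.log εc⁻¹ := Real.sq_sqrt (by linarith)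
  have hbb : b ^ 2 = 2 * Real.log εf⁻¹ := Real.sq_sqrt (by linarith)
  obtain ⟨hN0, haN, hE0, hlt⟩ :=
    thresholds_of_length hα0 hν0 hgap (by linarith) hgα ha0 hb0.le hN
  have hE : (1 - 2 * thetaParam α ν) * N * α + 2 * thetaParam α ν * N * (1 - p1Param α d T)
      = N * α * (1 + (1 + ν) * g) := by
    rw [hg]; unfold thetaParam; ring
  set E := N * α * (1 + (1 + ν) * g) with hEdef
  have hzacc : zAccParam α N εc = N * α + Real.sqrt (N * α) * a := rfl
  have hzrej : zRejParam α ν d T N εf = E - Real.sqrt E * b := by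
    rw [zRejParam, hE]
  rw [← hzacc, ← hzrej] at hlt
  have hl : ((d - d / S : ℕ) : ℝ) / d = 1 - α := by
    rw [Nat.cast_sub (Nat.div_le_self d S), Nat.cast_div hSd (by linarith), hα]
    field_simp
  refine ⟨?_, hlt, ?_, ?_⟩
  · rw [hzacc, mul_comm α]
    have := mul_nonneg (Real.sqrt_nonneg (N * α)) ha0.le
    linarith
  · intro k m
    rw [verif_pub hd]
    have hw : (fun i => passProb (enc m i)
        ((fingerprintScheme d S enc (zAccParam α N εc) (zRejParam α ν d T N εf)).sign k m i) (k i))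
        = fun _ => 1 - α := by
      funext i
      rw [← hl]
      exact passProb_honest (enc m i) (k i)
    rw [hw]
    refine le_trans (le_of_eq ?_)
      (sum_patternWeight_acc1_ge hα0 (by linarith) hN0 ha0.le haN hzacc)
    rw [haa, mul_div_cancel_left₀ _ (by norm_num : (3 : ℝ) ≠ 0), Real.log_inv, neg_neg,
      Real.exp_log hεc]
  · intro V _ _ _ A
    set Q := fingerprintScheme d S enc (zAccParam α N εc) (zRejParam α ν d T N εf) with hQ
    set u := 1 - b / Real.sqrt E with hu
    have hsE : 0 < Real.sqrt E := Real.sqrt_pos.mpr hE0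
    -- Equivalent to `0 < zrej`, which follows from `0 ≤ zacc < zrej`.
    have hu0 : 0 < u := by
      have hpos : 0 < E - Real.sqrt E * b := by
        rw [← hzrej]
        refine lt_of_le_of_lt ?_ hlt
        rw [hzacc]
        positivity
      have h1 : Real.sqrt E * b < Real.sqrt E * Real.sqrt E := by
        rw [Real.mul_self_sqrt hE0.le]; linarith
      rw [hu, sub_pos, div_lt_one hsE]
      exact lt_of_mul_lt_mul_left h1 hsE.le
    have hu1 : u ≤ 1 := by
      have : 0 ≤ b / Real.sqrt E := by positivity
      linarith
    -- The bound is relative to the weight of each transcript, so adaptive choices of the forger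
    -- cost no union bound.
    have hterm : ∀ m (o : (Fin K → Fin S) × (Fin N → Fin (d - d / S) → Bool)),
        ∑ k, (if o.1 ≠ m then A.outputProb Q k m o
          * (Q.verif (Q.pub k) o.1 o.2 Verdict.acc0 + Q.verif (Q.pub k) o.1 o.2 Verdict.acc1)
          else 0) ≤ εf * ∑ k, A.outputProb Q k m o := by
      intro m o
      have hout : 0 ≤ ∑ k, A.outputProb Q k m o :=
        Finset.sum_nonneg fun k _ => A.outputProb_nonneg Q k m o
      by_cases hmo : o.1 = m
      · simp only [hmo, ne_eq, not_true_eq_false, if_false, Finset.sum_const_zero]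
        positivity
      simp only [ne_eq, hmo, not_false_eq_true, if_true]
      have hdist : 2 * thetaParam α ν * (N : ℝ)
          ≤ ((Finset.univ.filter fun i => enc m i ≠ enc o.1 i).card : ℝ) :=
        henc m o.1 (Ne.symm hmo)
      have hEp : E ≤ N * α + (Finset.univ.filter fun i => enc m i ≠ enc o.1 i).card * g := by
        have := mul_le_mul_of_nonneg_right hdist hgap.le
        rw [hEdef]
        unfold thetaParam at this
        nlinarith
      have hexp := exp_mul_prod_le_exp (fun i => enc m i ≠ enc o.1 i) hE0 hb0.le hu hu0
        (by linarith) (by linarith) hEp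
      have hpg : 1 - α - g = p1Param α d T := by rw [hg]; ring
      rw [hpg, ← hzrej, hbb, mul_div_cancel_left₀ _ (by norm_num : (2 : ℝ) ≠ 0), Real.log_inv,
        neg_neg, Real.exp_log hεf] at hexp
      calc ∑ k, A.outputProb Q k m o
            * (Q.verif (Q.pub k) o.1 o.2 Verdict.acc0 + Q.verif (Q.pub k) o.1 o.2 Verdict.acc1)
          ≤ ∑ k, A.outputProb Q k m o
            * (Real.exp (-(Real.log u * zRejParam α ν d T N εf))
              * ∏ i, (passProb (enc o.1 i) (o.2 i) (k i)
                + u * (1 - passProb (enc o.1 i) (o.2 i) (k i)))) := by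
            refine Finset.sum_le_sum fun k _ =>
              mul_le_mul_of_nonneg_left ?_ (A.outputProb_nonneg Q k m o)
            have := verif_acc0_add_acc1_le enc _ _ hd hlt k o.1 o.2
              (Real.log_nonpos hu0.le hu1)
            rwa [Real.exp_log hu0] at this
        _ = Real.exp (-(Real.log u * zRejParam α ν d T N εf))
            * ∑ k, A.outputProb Q k m o * ∏ i, (passProb (enc o.1 i) (o.2 i) (k i)
                + u * (1 - passProb (enc o.1 i) (o.2 i) (k i))) := by
            rw [Finset.mul_sum]
            exact Finset.sum_congr rfl fun k _ => by ring
        _ ≤ Real.exp (-(Real.log u * zRejParam α ν d T N εf))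
            * ((∏ i, (u + (1 - u) * if enc m i ≠ enc o.1 i then p1Param α d T else 1 - α))
              * ∑ k, A.outputProb Q k m o) :=
            mul_le_mul_of_nonneg_left (A.sum_outputProb_mul_prod_le enc _ _ hS hd hSd hα hφ hp0
              m o hu0.le hu1) (Real.exp_pos _).le
        _ ≤ εf * ∑ k, A.outputProb Q k m o := by
            rw [← mul_assoc]
            exact mul_le_mul_of_nonneg_right hexp hout
    -- For each key the transcript probabilities sum to `1`, the squared norm of the key copies.
    have htotal : ∑ m, ∑ o, ∑ k, A.outputProb Q k m o
        = Fintype.card (Fin N → Fin d → Bool) := by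
      calc ∑ m, ∑ o, ∑ k, A.outputProb Q k m o
          = ∑ m, ∑ k, ∑ o, A.outputProb Q k m o :=
            Finset.sum_congr rfl fun m _ => Finset.sum_comm
        _ = ∑ k, ∑ m, ∑ o, A.outputProb Q k m o := Finset.sum_comm
        _ = _ := by
            simp only [A.sum_outputProb, hQ, norm_sq_tensorCopies_pub hd]
            simp
    have hcard : (0 : ℝ) < Fintype.card (Fin N → Fin d → Bool) := by
      exact_mod_cast Fintype.card_pos
    rw [ForgeryAdversary.forgeryProb, inv_mul_le_iff₀ hcard, mul_comm, ← htotal, Finset.mul_sum,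
      Finset.sum_comm]
    refine Finset.sum_le_sum fun m _ => ?_
    rw [Finset.mul_sum, Finset.sum_comm]
    refine Finset.sum_le_sum fun o _ => ?_
    refine le_trans (le_of_eq ?_) (hterm m o)
    exact Finset.sum_congr rfl fun k _ => by congr
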